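/- Let $\Bbbk$ be an algebraically closed field and let $\mathcal{C}$ be a weakly fiat $2$-category over $\Bbbk$. (A $\Bbbk$-linear category is \emph{finitary} if it is additive, idempotent split and Krull–Schmidt, with finitely many isomorphism classes of indecomposable objects and finite dimensional morphism spaces. A $2$-category is finitary if it has finitely many objects, its morphism categories are finitary $\Bbbk$-linear categories, composition is biadditive and $\Bbbk$-bilinear, and all identity $1$-morphisms are indecomposable. It is \emph{weakly fiat} if it is finitary and has a weak antiautoequivalence $*$, reversing $1$- and $2$-morphisms, such that $(\mathrm F,\mathrm F^*)$ is a pair of adjoint $1$-morphisms for every $1$-morphism $\mathrm F$.) For indecomposable $1$-morphisms write $\mathrm F\le_L \mathrm G$ (resp. $\mathrm F\le_J\mathrm G$) if $\mathrm G$ is isomorphic to a direct summand of $\mathrm H\circ\mathrm F$ (resp. of $\mathrm H\circ\mathrm F\circ\mathrm H'$) for some $1$-morphisms $\mathrm H,\mathrm H'$. The equivalence classes, on isomorphism classes of indecomposable $1$-morphisms, are the left (resp. two-sided) cells, which inherit the order. For a two-sided cell $\mathcal{J}$ let $B^{(\mathcal{J})}$ be the real algebra with basis the isomorphism classes of indecomposable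 $1$-morphisms in $\mathcal{J}$, with product induced by composition modulo all larger two-sided cells. The cell $\mathcal{J}$ is \emph{good} if there are an $x\in B^{(\mathcal{J})}$ all of whose coefficients in this basis are positive, integers $n>k\ge l\ge 1$ and real numbers $a_l,\dots,a_{n-1}\ge 0$ with $a_l\ne 0$ such that \[x^n+a_{n-1}x^{n-1}+\dots+a_{k+1}x^{k+1}=a_kx^k+a_{k-1}x^{k-1}+\dots+a_lx^l .\] A \emph{finitary $2$-representation} $\mathbf M$ of $\mathcal{C}$ is a $2$-functor, linear on $2$-morphisms, which assigns to each object a small finitary $\Bbbk$-linear category, to each $1$-morphism an additive functor and to each $2$-morphism a natural transformation. It is \emph{transitive} if for any indecomposable objects $X\in\mathbf M(\mathtt i)$ and $Y\in\mathbf M(\mathtt j)$ there is a $1$-morphism $\mathrm F$ such that $Y$ is isomorphic to a direct summand of $\mathrm F\,X$. The \emph{apex} of a transitive $\mathbf M$ is the unique maximal two-sided cell of the quotient of $\mathcal{C}$ by the annihilator of $\mathbf M$, regarded as a two-sided cell of $\mathcal{C}$. Two $2$-representations are \emph{equivalent} if there is a $2$-natural transformation between them whose value at each object is an equivalence. (Here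 $2$-categories, $2$-functors and $2$-natural transformations may be strict or, more generally, bicategories, pseudofunctors and pseudonatural transformations.) For transitive $2$-representations $\mathbf N$ and $\mathbf K$, let $\mathrm{Dext}(\mathbf N,\mathbf K)$ be the set of all non-empty sets $\Theta$ of isomorphism classes of indecomposable $1$-morphisms for which there are a finitary $2$-representation $\mathbf M$ and a $2$-subrepresentation $\mathbf K'$ of $\mathbf M$ (given by full subcategories closed under isomorphisms, finite direct sums and direct summands) such that $\mathbf K'$ is equivalent to $\mathbf K$, the quotient of $\mathbf M$ by the ideal generated by the identity morphisms of all objects of $\mathbf K'$ is equivalent to $\mathbf N$, and $\Theta$ consists of the classes of those indecomposable $\mathrm F$ for which there is an indecomposable object $X$ of $\mathbf M$ not in $\mathbf K'$ such that $\mathrm F\,X$ has an indecomposable direct summand in $\mathbf K'$. \textbf{Theorem.} Let $\mathbf K$ and $\mathbf N$ be transitive finitary $2$-representations of $\mathcal{C}$ with apexes $\mathcal{J}_{\mathbf K}$ and $\mathcal{J}_{\mathbf N}$. Assume that (a) $\mathcal{J}_{\mathbf K}$ is good, (b) $\mathcal{J}_{\mathbf K}\le_J\mathcal{J}_{\mathbf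 N}$, (c) for every left cell $\mathcal L$ contained in $\mathcal{J}_{\mathbf N}$ there is a left cell $\mathcal L'$ contained in $\mathcal{J}_{\mathbf K}$ with $\mathcal L'\le_L\mathcal L$. Then $\mathrm{Dext}(\mathbf N,\mathbf K)=\varnothing$. -/

import Mathlib

open CategoryTheory Bicategory Limits Opposite

universe w v u v₁ u₁

noncomputable section

namespace Finitary

attribute [instance] hasBinaryBiproducts_of_finite_biproducts

/-! ### Finitary categories -/

section Categories

variable (A : Type u₁) [Category.{v₁} A]

/-- `Y` is a direct summand of `X`. In an idempotent split additive category (the only case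
used below) direct summands and retracts agree. -/
def IsSummand {A : Type u₁} [Category.{v₁} A] (Y X : A) : Prop :=
  Nonempty (Retract Y X)

variable [Preadditive A] [HasFiniteBiproducts A]

/-- The set of isomorphism classes of indecomposable objects of an additive category. -/
def IndClass : Type u₁ :=
  _root_.Quotient ((isIsomorphicSetoid A).comap (Subtype.val : {X : A // Indecomposable X} → A))

variable (k : Type*) [Field k]

/-- A `k`-linear additive category is finitary if it is idempotent split and Krull-Schmidt,
with finitely many isomorphism classes of indecomposable objects and finite dimensional
spaces of morphisms. -/
class IsFinitaryCategory [Linear k A] : Prop where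
  idempotentSplit : IsIdempotentComplete A
  krullSchmidt : ∀ X : A, ∃ (n : ℕ) (Y : Fin n → A),
    (∀ i, IsLocalRing (End (Y i))) ∧ Nonempty (X ≅ ⨁ Y)
  finite_indClass : Finite (IndClass A)
  finiteDimensional_hom : ∀ X Y : A, FiniteDimensional k (X ⟶ Y)

end Categories

/-! ### Finitary and weakly fiat 2-categories -/

/-- Finitary 2-categories. Strictness of `C` is not required; strict 2-categories are
bicategories. The composite `G ∘ F` is written `F ≫ G`. -/
class IsFinitary (k : Type*) [Field k] (C : Type u) [Bicategory.{w, v} C]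
    [∀ a b : C, Preadditive (a ⟶ b)] [∀ a b : C, Linear k (a ⟶ b)]
    [∀ a b : C, HasFiniteBiproducts (a ⟶ b)] : Prop where
  finite_obj : Finite C
  finitary_hom : ∀ a b : C, IsFinitaryCategory (a ⟶ b) k
  whiskerLeft_add : ∀ {a b c : C} (f : a ⟶ b) {g h : b ⟶ c} (η θ : g ⟶ h),
    f ◁ (η + θ) = f ◁ η + f ◁ θ
  whiskerRight_add : ∀ {a b c : C} {f g : a ⟶ b} (η θ : f ⟶ g) (h : b ⟶ c),
    (η + θ) ▷ h = η ▷ h + θ ▷ h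
  whiskerLeft_smul : ∀ {a b c : C} (f : a ⟶ b) {g h : b ⟶ c} (r : k) (η : g ⟶ h),
    f ◁ (r • η) = r • (f ◁ η)
  whiskerRight_smul : ∀ {a b c : C} {f g : a ⟶ b} (r : k) (η : f ⟶ g) (h : b ⟶ c),
    (r • η) ▷ h = r • (η ▷ h)
  id_indecomposable : ∀ a : C, Indecomposable (𝟙 a)

/-- A weak antiautoequivalence `*` of a bicategory which is the identity on objects and reverses
1-morphisms and 2-morphisms, such that `(F, F*)` is a pair of adjoint 1-morphisms for every `F`. -/
structure WeaklyFiatStructure (C : Type u) [Bicategory.{w, v} C] where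
  /-- the action of `*` on 1-morphisms and on 2-morphisms -/
  star (a b : C) : (a ⟶ b)ᵒᵖ ⥤ (b ⟶ a)
  isEquivalence_star (a b : C) : (star a b).IsEquivalence
  starId (a : C) : (star a a).obj (op (𝟙 a)) ≅ 𝟙 a
  starComp {a b c : C} (f : a ⟶ b) (g : b ⟶ c) :
    (star a c).obj (op (f ≫ g)) ≅ (star b c).obj (op g) ≫ (star a b).obj (op f)
  star_whiskerLeft {a b c : C} (f : a ⟶ b) {g h : b ⟶ c} (η : g ⟶ h) :
    (star a c).map (f ◁ η).op ≫ (starComp f g).hom =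
      (starComp f h).hom ≫ (star b c).map η.op ▷ (star a b).obj (op f)
  star_whiskerRight {a b c : C} {f g : a ⟶ b} (η : f ⟶ g) (h : b ⟶ c) :
    (star a c).map (η ▷ h).op ≫ (starComp f h).hom =
      (starComp g h).hom ≫ (star b c).obj (op h) ◁ (star a b).map η.op
  star_associator {a b c d : C} (f : a ⟶ b) (g : b ⟶ c) (h : c ⟶ d) :
    (star a d).map (α_ f g h).hom.op ≫ (starComp (f ≫ g) h).hom ≫
        (star c d).obj (op h) ◁ (starComp f g).hom =
      (starComp f (g ≫ h)).hom ≫ (starComp g h).hom ▷ (star a b).obj (op f) ≫ (α_ _ _ _).hom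
  star_leftUnitor {a b : C} (f : a ⟶ b) :
    (star a b).map (λ_ f).hom.op ≫ (starComp (𝟙 a) f).hom ≫
      (star a b).obj (op f) ◁ (starId a).hom ≫ (ρ_ _).hom = 𝟙 _
  star_rightUnitor {a b : C} (f : a ⟶ b) :
    (star a b).map (ρ_ f).hom.op ≫ (starComp f (𝟙 b)).hom ≫
      (starId b).hom ▷ (star a b).obj (op f) ≫ (λ_ _).hom = 𝟙 _
  /-- `F*` is right adjoint to `F` -/
  adj {a b : C} (f : a ⟶ b) : Bicategory.Adjunction f ((star a b).obj (op f))

/-- A (finitary) 2-category is weakly fiat if it has a weak antiautoequivalence as above. -/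
def IsWeaklyFiat (C : Type u) [Bicategory.{w, v} C] : Prop :=
  Nonempty (WeaklyFiatStructure C)

/-! ### Combinatorics of 1-morphisms -/

section Combinatorics

variable (C : Type u) [Bicategory.{w, v} C] [∀ a b : C, Preadditive (a ⟶ b)]
  [∀ a b : C, HasFiniteBiproducts (a ⟶ b)]

/-- The set of isomorphism classes of indecomposable 1-morphisms. -/
def IndMor : Type (max u v) := Σ p : C × C, IndClass (p.1 ⟶ p.2)

variable {C}

/-- The isomorphism class of an indecomposable 1-morphism. -/
def cls {a b : C} (F : a ⟶ b) (hF : Indecomposable F) : IndMor C :=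
  ⟨(a, b), _root_.Quotient.mk _ ⟨F, hF⟩⟩

/-- The left preorder: `F ≤_L G` if `G` is a direct summand of `H ∘ F` for some `H`. -/
def LeL (s t : IndMor C) : Prop :=
  ∃ (a b c : C) (F : a ⟶ b) (hF : Indecomposable F) (G : a ⟶ c) (hG : Indecomposable G)
    (H : b ⟶ c), s = cls F hF ∧ t = cls G hG ∧ IsSummand G (F ≫ H)

/-- The two-sided preorder: `F ≤_J G` if `G` is a direct summand of `H₂ ∘ F ∘ H₁` for some
`H₁` and `H₂`. -/
def LeJ (s t : IndMor C) : Prop :=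
  ∃ (a b c d : C) (F : b ⟶ c) (hF : Indecomposable F) (G : a ⟶ d) (hG : Indecomposable G)
    (H₁ : a ⟶ b) (H₂ : c ⟶ d),
    s = cls F hF ∧ t = cls G hG ∧ IsSummand G (H₁ ≫ F ≫ H₂)

/-- Left cells: equivalence classes of the left preorder. -/
def IsLeftCell (L : Set (IndMor C)) : Prop :=
  ∃ s, L = {t | LeL s t ∧ LeL t s}

/-- Two-sided cells: equivalence classes of the two-sided preorder. -/
def IsTwoSidedCell (J : Set (IndMor C)) : Prop :=
  ∃ s, J = {t | LeJ s t ∧ LeJ t s}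

/-- The order induced by `≤_L` on left cells. -/
def CellLeL (L L' : Set (IndMor C)) : Prop := ∀ s ∈ L, ∀ t ∈ L', LeL s t

/-- The order induced by `≤_J` on two-sided cells. -/
def CellLeJ (J J' : Set (IndMor C)) : Prop := ∀ s ∈ J, ∀ t ∈ J', LeJ s t

/-- The multiplicity of `h` as a direct summand of the composite `f ∘ g`
(zero if `f` and `g` are not composable or if `h` is not parallel to `f ∘ g`): the largest `n`
such that the direct sum of `n` copies of `h` is a direct summand of `f ∘ g`. -/
def structureConstant (f g h : IndMor C) : ℕ :=
  sSup {n : ℕ | ∃ (a b c : C) (G : a ⟶ b) (hG : Indecomposable G) (F : b ⟶ c)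
    (hF : Indecomposable F) (H : a ⟶ c) (hH : Indecomposable H),
    f = cls F hF ∧ g = cls G hG ∧ h = cls H hH ∧
      IsSummand (⨁ fun _ : Fin n => H) (G ≫ F)}

/-- The real vector space `B^(J)` with basis `J` (the set `J` is finite). -/
abbrev CellAlgebra (J : Set (IndMor C)) : Type _ := J → ℝ

/-- The product of `B^(J)`: composition of 1-morphisms, where all direct summands outside of `J`
(they lie in strictly larger two-sided cells) are discarded. -/
def cellMul {J : Set (IndMor C)} (x y : CellAlgebra J) : CellAlgebra J :=
  fun h => ∑ᶠ p : J × J, x p.1 * y p.2 * (structureConstant p.1.1 p.2.1 h.1 : ℝ)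

/-- Positive powers in the algebra `B^(J)`, which need not be unital; the exponent `0` is not
used. -/
def cellPow {J : Set (IndMor C)} (x : CellAlgebra J) : ℕ → CellAlgebra J
  | 0 => 0
  | 1 => x
  | n + 2 => cellMul (cellPow x (n + 1)) x

/-- Good two-sided cells: some `x` in the positive cone of `B^(J)` (all coefficients are positive)
satisfies `x^n + a_{n-1} x^{n-1} + ⋯ + a_{k+1} x^{k+1} = a_k x^k + ⋯ + a_l x^l` with `n > k ≥ l ≥ 1`,
all `a_i ≥ 0` and `a_l ≠ 0`. -/
def IsGood (J : Set (IndMor C)) : Prop :=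
  ∃ x : CellAlgebra J, (∀ s, 0 < x s) ∧
    ∃ (n k l : ℕ) (a : ℕ → ℝ), 1 ≤ l ∧ l ≤ k ∧ k < n ∧ (∀ i, 0 ≤ a i) ∧ a l ≠ 0 ∧
      cellPow x n + ∑ i ∈ Finset.Ioo k n, a i • cellPow x i =
        ∑ i ∈ Finset.Icc l k, a i • cellPow x i

end Combinatorics

/-! ### Finitary 2-representations -/

section Representations

variable (k : Type*) [Field k] (C : Type u) [Bicategory.{w, v} C]
  [∀ a b : C, Preadditive (a ⟶ b)] [∀ a b : C, Linear k (a ⟶ b)]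
  [∀ a b : C, HasFiniteBiproducts (a ⟶ b)]

/-- Finitary 2-representations: pseudofunctors (for instance, strict 2-functors), linear on
2-morphisms, which assign to objects small finitary `k`-linear categories, to 1-morphisms additive
functors, and to 2-morphisms natural transformations. -/
structure FinRep where
  /-- the underlying pseudofunctor -/
  ps : Pseudofunctor C Cat.{v₁, u₁}
  preadditive : ∀ i, Preadditive (ps.obj i)
  linear : ∀ i, Linear k (ps.obj i)
  hasFiniteBiproducts : ∀ i, HasFiniteBiproducts (ps.obj i)
  finitary : ∀ i, IsFinitaryCategory (ps.obj i) k
  additive : ∀ {i j : C} (F : i ⟶ j), (ps.map F).toFunctor.Additive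
  map₂_add : ∀ {i j : C} {F G : i ⟶ j} (α β : F ⟶ G) (X : ps.obj i),
    (ps.map₂ (α + β)).toNatTrans.app X =
      (ps.map₂ α).toNatTrans.app X + (ps.map₂ β).toNatTrans.app X
  map₂_smul : ∀ {i j : C} {F G : i ⟶ j} (r : k) (α : F ⟶ G) (X : ps.obj i),
    (ps.map₂ (r • α)).toNatTrans.app X = r • (ps.map₂ α).toNatTrans.app X

attribute [instance] FinRep.preadditive FinRep.linear FinRep.hasFiniteBiproducts
  FinRep.finitary FinRep.additive

variable {k C}

namespace FinRep

variable (M : FinRep.{w, v, u, v₁, u₁} k C)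

/-- The category `M(i)`. -/
abbrev obj (i : C) : Type u₁ := M.ps.obj i

/-- The object `F X` for a 1-morphism `F`. -/
abbrev act {i j : C} (F : i ⟶ j) (X : M.obj i) : M.obj j := (M.ps.map F).toFunctor.obj X

/-- The action preorder `X → Y`: there is a 1-morphism `F` such that `Y` is a direct summand of
`F X`. -/
def Reaches {i j : C} (X : M.obj i) (Y : M.obj j) : Prop :=
  ∃ F : i ⟶ j, IsSummand Y (M.act F X)

/-- `M` is transitive if the action preorder is the full relation on indecomposable objects. -/
def IsTransitive : Prop :=
  ∀ (i j : C) (X : M.obj i) (Y : M.obj j), Indecomposable X → Indecomposable Y → M.Reaches X Y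

/-- The 2-morphism `α` belongs to the annihilator of `M`. -/
def InAnnihilator {i j : C} {F G : i ⟶ j} (α : F ⟶ G) : Prop :=
  ∀ X : M.obj i, (M.ps.map₂ α).toNatTrans.app X = 0

/-- `J` is a two-sided cell of `C` which survives in the quotient of `C` by the annihilator
of `M`: no 1-morphism in `J` becomes zero there. -/
def IsSurvivingCell (J : Set (IndMor C)) : Prop :=
  IsTwoSidedCell J ∧
    ∀ (i j : C) (F : i ⟶ j) (hF : Indecomposable F), cls F hF ∈ J → ¬ M.InAnnihilator (𝟙 F)

/-- `J` is a maximal two-sided cell of the quotient of `C` by the annihilator of `M`. -/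
def IsMaximalSurvivingCell (J : Set (IndMor C)) : Prop :=
  M.IsSurvivingCell J ∧ ∀ J', M.IsSurvivingCell J' → CellLeJ J J' → J' = J

/-- `J` is the apex of `M`: the unique maximal two-sided cell of the quotient of `C` by the
annihilator of `M`. -/
def IsApex (J : Set (IndMor C)) : Prop :=
  M.IsMaximalSurvivingCell J ∧ ∀ J', M.IsMaximalSurvivingCell J' → J' = J

/-! ### Subrepresentations and quotients -/

/-- The objects satisfying `P` form a 2-subrepresentation: `P` defines full subcategories
of all `M(i)` which are invariant under the action of `C` and closed under isomorphisms,
finite direct sums and direct summands. The corresponding 2-representation is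
`P.fullsubcategory`. -/
class IsSubrep (P : M.ps.ObjectProperty) : Prop extends
    P.IsClosedUnderMapObj, P.IsClosedUnderIsomorphisms where
  containsZero : ∀ i, (P.prop i).ContainsZero
  biprod : ∀ (i : C) (X Y : M.obj i), P.prop i X → P.prop i Y → P.prop i (X ⊞ Y)
  stableUnderRetracts : ∀ i, (P.prop i).IsStableUnderRetracts

section Quotient

variable {M} (P : M.ps.ObjectProperty)

/-- The ideal of `M(i)` generated by the identity morphisms of all objects satisfying `P`. -/
def ideal (i : C) (X Y : M.obj i) : AddSubgroup (X ⟶ Y) :=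
  AddSubgroup.closure {h | ∃ (Z : M.obj i) (f : X ⟶ Z) (g : Z ⟶ Y), P.prop i Z ∧ h = f ≫ g}

/-- Congruence modulo this ideal. -/
def idealRel (i : C) : HomRel (M.obj i) := fun X Y f g => f - g ∈ ideal P i X Y

/-- The quotient of `M(i)` by this ideal. -/
abbrev QuotObj (i : C) : Type u₁ := CategoryTheory.Quotient (idealRel P i)

theorem map_ideal [P.IsClosedUnderMapObj] {i j : C} (F : i ⟶ j) {X Y : M.obj i} (f : X ⟶ Y)
    (hf : f ∈ ideal P i X Y) :
    (M.ps.map F).toFunctor.map f ∈ ideal P j (M.act F X) (M.act F Y) := by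
  unfold ideal at hf
  induction hf using AddSubgroup.closure_induction with
  | mem f h =>
    obtain ⟨Z, a, b, hZ, rfl⟩ := h
    exact AddSubgroup.subset_closure ⟨M.act F Z, _, _, P.map_obj hZ F, Functor.map_comp _ _ _⟩
  | zero => rw [Functor.map_zero]; exact zero_mem _
  | add f g _ _ hf hg => rw [Functor.map_add]; exact add_mem hf hg
  | neg f _ hf => rw [Functor.map_neg]; exact neg_mem hf

/-- The functor induced by `M(F)` on the quotient categories. -/
def quotMap [P.IsClosedUnderMapObj] {i j : C} (F : i ⟶ j) : QuotObj P i ⥤ QuotObj P j :=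
  CategoryTheory.Quotient.lift _
    ((M.ps.map F).toFunctor ⋙ CategoryTheory.Quotient.functor (idealRel P j))
    (fun X Y f g h => CategoryTheory.Quotient.sound _ (by
      have := map_ideal P F _ h
      rwa [Functor.map_sub] at this))

/-- The quotient of the 2-representation `M` by the ideal generated by the identity morphisms
of all objects satisfying `P`. -/
def quotient [P.IsClosedUnderMapObj] : Pseudofunctor C Cat.{v₁, u₁} where
  obj i := Cat.of (QuotObj P i)
  map F := (quotMap P F).toCatHom
  map₂ {i j F G} α := NatTrans.toCatHom₂ (CategoryTheory.Quotient.natTransLift _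
    (F := quotMap P F) (G := quotMap P G)
    (Functor.whiskerRight (M.ps.map₂ α).toNatTrans (CategoryTheory.Quotient.functor _)))
  mapId i := Cat.Hom.isoMk (CategoryTheory.Quotient.natIsoLift _
    (F := quotMap P (𝟙 i)) (G := 𝟭 _)
    (Functor.isoWhiskerRight (Cat.Hom.toNatIso (M.ps.mapId i))
      (CategoryTheory.Quotient.functor _)))
  mapComp F G := Cat.Hom.isoMk (CategoryTheory.Quotient.natIsoLift _
    (F := quotMap P (F ≫ G)) (G := quotMap P F ⋙ quotMap P G)
    (Functor.isoWhiskerRight (Cat.Hom.toNatIso (M.ps.mapComp F G))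
      (CategoryTheory.Quotient.functor _)))
  map₂_id F := by
    apply Cat.Hom₂.ext
    ext X
    exact congrArg (fun t => (CategoryTheory.Quotient.functor _).map (t.toNatTrans.app X.as))
      (M.ps.map₂_id F)
  map₂_comp α β := by
    apply Cat.Hom₂.ext
    ext X
    exact congrArg (fun t => (CategoryTheory.Quotient.functor _).map (t.toNatTrans.app X.as))
      (M.ps.map₂_comp α β)
  map₂_whisker_left F _ _ η := by
    apply Cat.Hom₂.ext
    ext X
    exact congrArg (fun t => (CategoryTheory.Quotient.functor _).map (t.toNatTrans.app X.as))
      (M.ps.map₂_whisker_left F η)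
  map₂_whisker_right η H := by
    apply Cat.Hom₂.ext
    ext X
    exact congrArg (fun t => (CategoryTheory.Quotient.functor _).map (t.toNatTrans.app X.as))
      (M.ps.map₂_whisker_right η H)
  map₂_associator F G H := by
    apply Cat.Hom₂.ext
    ext X
    exact congrArg (fun t => (CategoryTheory.Quotient.functor _).map (t.toNatTrans.app X.as))
      (M.ps.map₂_associator F G H)
  map₂_left_unitor F := by
    apply Cat.Hom₂.ext
    ext X
    exact congrArg (fun t => (CategoryTheory.Quotient.functor _).map (t.toNatTrans.app X.as))
      (M.ps.map₂_left_unitor F)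
  map₂_right_unitor F := by
    apply Cat.Hom₂.ext
    ext X
    exact congrArg (fun t => (CategoryTheory.Quotient.functor _).map (t.toNatTrans.app X.as))
      (M.ps.map₂_right_unitor F)

end Quotient

/-! ### Discrete extensions -/

/-- Equivalence of 2-representations: a (strong) 2-natural transformation whose value at each
object is an equivalence of categories. -/
def Equivalent (F G : Pseudofunctor C Cat.{v₁, u₁}) : Prop :=
  ∃ η : F.StrongTrans G, ∀ i : C, (η.app i).toFunctor.IsEquivalence

/-- The set `Θ` attached to a 2-subrepresentation `P` of `M`: all isomorphism classes of
indecomposable 1-morphisms `F` for which there is an indecomposable object `X` not in `P` such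
that `F X` has an indecomposable direct summand in `P`. -/
def theta (P : M.ps.ObjectProperty) : Set (IndMor C) :=
  {s | ∃ (i j : C) (F : i ⟶ j) (hF : Indecomposable F), s = cls F hF ∧
    ∃ (X : M.obj i) (Y : M.obj j), Indecomposable X ∧ ¬ P.prop i X ∧
      Indecomposable Y ∧ P.prop j Y ∧ IsSummand Y (M.act F X)}

/-- `Dext(N, K)`: all non-empty sets `Θ` arising from short exact sequences
`0 → K' → M → N' → 0`, where `K'` is a 2-subrepresentation of `M` equivalent to `K`, and the
quotient `N'` of `M` by the ideal generated by `K'` is equivalent to `N`. -/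
def Dext (N K : FinRep.{w, v, u, v₁, u₁} k C) : Set (Set (IndMor C)) :=
  {Θ | Θ.Nonempty ∧ ∃ (M : FinRep.{w, v, u, v₁, u₁} k C) (P : M.ps.ObjectProperty)
    (_ : M.IsSubrep P), Equivalent P.fullsubcategory K.ps ∧ Equivalent (quotient P) N.ps ∧
      Θ = M.theta P}

end FinRep

end Representations

end Finitary

end

/-!
Let `0 → K' → M → N' → 0` be a short exact sequence as in the definition of `Dext N K`, and call
`F` connecting if `F X` has an indecomposable summand `Y` in `K'` for some indecomposable `X`
outside `K'`. Connecting 1-morphisms have to be excluded.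

Weak fiatness enters once: a 1-morphism `F` which annihilates `K'` is not connecting, because
every morphism `F X ⟶ Y` with `Y` in `K'` factors through the counit `F F* Y ⟶ Y`, and `F F* Y = 0`
(`eq_zero_of_isZero_act`). By transitivity, the 1-morphisms in the apex act transitively on the
indecomposable objects, and a 1-morphism above the apex but outside of it acts by zero
(`IsTransitive.exists_mem_apex`, `IsMaximalSurvivingCell.mem_of_leJ`). By Krull-Schmidt this
passes from `K` and `N` to the indecomposable objects of `M` inside and outside `K'`.

Suppose that `F` is connecting, via `X` and `Y`. If the apexes differ, the apex of `N` annihilates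
`K`. Since `X` is a summand of `G X` for some `G` in the apex of `N`, the composite `F ∘ G`, which
annihilates `K'`, is connecting: a contradiction.

If both apexes equal `J`, then `Y` is a summand of `G Y` for some `G` in `J`; a summand of `G ∘ F`
which connects `X` to `Y` does not annihilate `K`, hence lies in `J`, and `F` may be assumed to be
in `J`. Let `x` be the positive element of `B^(J)` which makes `J` good, and `T` the matrix of
multiplicities through which it acts on the indecomposable objects of `M`. Indecomposable
1-morphisms above `J` and outside `J` annihilate `K` and `N`, hence map `M` to `K'`, hence
annihilate `M`. So powers of `x` act by powers of `T` (`actionMatrix_cellPow`), and `T` is a root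
of a polynomial with one sign change. The matrix `T` is block triangular with positive diagonal
blocks, and its off-diagonal block is nonzero since `F` is connecting. This is impossible
(`offdiagonal_eq_zero`): if `r` is the positive root of the polynomial, its quotient `q` by `X - r`
has nonnegative coefficients, and `A = q(T)` satisfies `T A = r A = A T`. For the part `w` in `K'`
of a column of `A`, the vector `(T - r) w` is nonnegative, is supported outside `K'` and is killed
by `A`, whose diagonal is positive, so it vanishes, and with it the off-diagonal block.
-/

universe v₂ u₂

noncomputable section

namespace Finitary

/-! ### Local endomorphism rings -/

section LocalRings

theorem isUnit_of_mul_eq_one_of_isLocalRing {R : Type*} [Ring R] [IsLocalRing R] {a b : R}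
    (h : a * b = 1) : IsUnit a ∧ IsUnit b := by
  -- `b * a` is idempotent, hence equal to `0` or `1`
  have hba : b * a = 1 := by
    have hid : b * a * (b * a) = b * a := by
      rw [mul_assoc, ← mul_assoc a, h, one_mul]
    rcases IsLocalRing.isUnit_or_isUnit_of_add_one (add_sub_cancel (b * a) 1) with hu | hu
    · exact hu.mul_left_cancel (by rw [hid, mul_one])
    · have h0 : b * a = 0 := hu.mul_left_cancel (by rw [sub_mul, one_mul, hid, sub_self, mul_zero])
      have h1 : (1 : R) = 0 := by
        calc (1 : R) = a * (b * a) * b := by rw [mul_assoc, mul_assoc, h, mul_one, h]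
          _ = 0 := by rw [h0, mul_zero, zero_mul]
      exact absurd h1 one_ne_zero
  exact ⟨⟨⟨a, b, h, hba⟩, rfl⟩, ⟨⟨b, a, hba, h⟩, rfl⟩⟩

/-- Over an algebraically closed field `k`, a finite dimensional local algebra has residue
field `k`. -/
theorem exists_residue_character (k : Type*) {R : Type*} [Field k] [IsAlgClosed k] [Ring R]
    [IsLocalRing R] [Algebra k R] [FiniteDimensional k R] :
    ∃ χ : R →+* k, ∀ f, χ f = 0 ↔ ¬ IsUnit f := by
  have hmul : ∀ f g : R, ¬ IsUnit g → ¬ IsUnit (f * g) := fun f g hg hfg => by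
    obtain ⟨u, hu⟩ := hfg
    exact hg (isUnit_of_mul_eq_one_of_isLocalRing
      (show (↑u⁻¹ * f) * g = 1 by rw [mul_assoc, ← hu, Units.inv_mul])).2
  have hmul' : ∀ f g : R, ¬ IsUnit f → ¬ IsUnit (f * g) := fun f g hf hfg => by
    obtain ⟨u, hu⟩ := hfg
    exact hf (isUnit_of_mul_eq_one_of_isLocalRing
      (show f * (g * ↑u⁻¹) = 1 by rw [← mul_assoc, ← hu, Units.mul_inv])).1
  have hadd : ∀ f g : R, ¬ IsUnit f → ¬ IsUnit g → ¬ IsUnit (f + g) := fun f g hf hg =>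
    IsLocalRing.nonunits_add hf hg
  have huniq : ∀ (f : R) (r s : k), ¬ IsUnit (f - algebraMap k R r) →
      ¬ IsUnit (f - algebraMap k R s) → r = s := by
    intro f r s hr hs
    by_contra hne
    have h1 : ¬ IsUnit (-(f - algebraMap k R s)) := by rwa [IsUnit.neg_iff]
    have h2 := hadd _ _ hr h1
    apply h2
    have h3 : f - algebraMap k R r + -(f - algebraMap k R s) = algebraMap k R (s - r) := by
      rw [map_sub]; abel
    rw [h3]
    exact (IsUnit.mk0 _ (sub_ne_zero.2 (Ne.symm hne))).map (algebraMap k R)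
  have hex : ∀ f : R, ∃ r : k, ¬ IsUnit (f - algebraMap k R r) := by
    intro f
    obtain ⟨r, hr⟩ := spectrum.nonempty_of_isAlgClosed_of_finiteDimensional k f
    refine ⟨r, fun h => hr ?_⟩
    rw [spectrum.mem_resolventSet_iff, ← neg_sub]
    exact h.neg
  choose c hc using hex
  have hval : ∀ f r, ¬ IsUnit (f - algebraMap k R r) → c f = r := fun f r h =>
    huniq f _ _ (hc f) h
  refine ⟨{ toFun := c, map_one' := ?_, map_mul' := ?_, map_zero' := ?_, map_add' := ?_ }, ?_⟩
  · exact hval _ _ (by simp)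
  · intro f g
    apply hval
    have : f * g - algebraMap k R (c f * c g) = f * (g - algebraMap k R (c g)) +
        (f - algebraMap k R (c f)) * algebraMap k R (c g) := by
      rw [map_mul]; noncomm_ring
    rw [this]
    exact hadd _ _ (hmul _ _ (hc g)) (hmul' _ _ (hc f))
  · exact hval _ _ (by simp)
  · intro f g
    apply hval
    have : f + g - algebraMap k R (c f + c g) = (f - algebraMap k R (c f)) +
        (g - algebraMap k R (c g)) := by
      rw [map_add]; abel
    rw [this]
    exact hadd _ _ (hc f) (hc g)
  · intro f
    change c f = 0 ↔ _
    constructor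
    · intro h
      have := hc f
      rwa [h, map_zero, sub_zero] at this
    · intro h
      exact hval _ _ (by rwa [map_zero, sub_zero])

end LocalRings

section KrullSchmidt

variable {A : Type u₁} [Category.{v₁} A]

theorem IsSummand.trans {X Y Z : A} (h : IsSummand X Y) (h' : IsSummand Y Z) : IsSummand X Z :=
  ⟨h.some.trans h'.some⟩

theorem IsSummand.of_iso {X Y : A} (e : X ≅ Y) : IsSummand X Y := ⟨Retract.ofIso e⟩

theorem IsSummand.map {B : Type*} [Category* B] {X Y : A} (h : IsSummand X Y) (G : A ⥤ B) :
    IsSummand (G.obj X) (G.obj Y) := ⟨h.some.map G⟩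

variable [Preadditive A]

theorem IsSummand.isZero {X Y : A} (h : IsSummand X Y) (hY : IsZero Y) : IsZero X := by
  obtain ⟨r⟩ := h
  rw [IsZero.iff_id_eq_zero, ← r.retract, hY.eq_of_tgt r.i 0, zero_comp]

theorem not_isZero_of_isLocalRing {Y : A} (hY : IsLocalRing (End Y)) : ¬ IsZero Y := fun h =>
  one_ne_zero (α := End Y) (h.eq_of_src _ _)

/-- A nonzero retract of an object with local endomorphism ring is isomorphic to it. -/
theorem IsSummand.nonempty_iso {X Y : A} (h : IsSummand X Y) (hX : ¬ IsZero X)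
    (hY : IsLocalRing (End Y)) : Nonempty (X ≅ Y) := by
  obtain ⟨r⟩ := h
  let e : End Y := r.r ≫ r.i
  have hid : e * e = e := by
    change (r.r ≫ r.i) ≫ r.r ≫ r.i = r.r ≫ r.i
    rw [Category.assoc, r.retract_assoc]
  rcases IsLocalRing.isUnit_or_isUnit_of_add_one (add_sub_cancel e 1) with hu | hu
  · exact ⟨r.i, r.r, r.retract, show e = 1 from hu.mul_left_cancel (by rw [hid, mul_one])⟩
  · have h0 : e = 0 := hu.mul_left_cancel (by rw [sub_mul, one_mul, hid, sub_self, mul_zero])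
    refine absurd ?_ hX
    rw [IsZero.iff_id_eq_zero]
    calc 𝟙 X = r.i ≫ (r.r ≫ r.i) ≫ r.r := by simp [r.retract]
      _ = r.i ≫ (0 : Y ⟶ Y) ≫ r.r := by rw [show r.r ≫ r.i = (0 : Y ⟶ Y) from h0]
      _ = 0 := by simp

theorem indecomposable_of_isLocalRing [HasBinaryBiproducts A] {Y : A}
    (hY : IsLocalRing (End Y)) : Indecomposable Y := by
  refine ⟨not_isZero_of_isLocalRing hY, fun U W e => ?_⟩
  by_contra! h
  let r : Retract U Y := ⟨biprod.inl ≫ e.inv, e.hom ≫ biprod.fst, by simp⟩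
  let r' : Retract W Y := ⟨biprod.inr ≫ e.inv, e.hom ≫ biprod.snd, by simp⟩
  let p : End Y := r.r ≫ r.i
  let q : End Y := r'.r ≫ r'.i
  have hpq : p + q = 1 := by
    change (e.hom ≫ biprod.fst) ≫ (biprod.inl ≫ e.inv) +
      (e.hom ≫ biprod.snd) ≫ biprod.inr ≫ e.inv = 𝟙 Y
    have := congrArg (fun t => e.hom ≫ t ≫ e.inv) (biprod.total (X := U) (Y := W))
    rw [Preadditive.add_comp, Preadditive.comp_add] at this
    simpa only [Category.assoc, Category.id_comp, Iso.hom_inv_id] using this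
  have hpq0 : r.r ≫ r.i ≫ r'.r = 0 := by simp [r, r']
  have hqp0 : r'.r ≫ r'.i ≫ r.r = 0 := by simp [r, r']
  rcases IsLocalRing.isUnit_or_isUnit_of_add_one hpq with hu | hu
  · have : IsIso (r.r ≫ r.i) := (isUnit_iff_isIso p).1 hu
    have h0 : r'.r = 0 := by
      rw [← cancel_epi (r.r ≫ r.i), Category.assoc, hpq0, comp_zero]
    exact h.2 ((IsZero.iff_id_eq_zero _).2 (by rw [← r'.retract, h0, comp_zero]))
  · have : IsIso (r'.r ≫ r'.i) := (isUnit_iff_isIso q).1 hu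
    have h0 : r.r = 0 := by
      rw [← cancel_epi (r'.r ≫ r'.i), Category.assoc, hqp0, comp_zero]
    exact h.1 ((IsZero.iff_id_eq_zero _).2 (by rw [← r.retract, h0, comp_zero]))

theorem isLocalRing_end_of_iso {X Y : A} (e : X ≅ Y) (hX : IsLocalRing (End X)) :
    IsLocalRing (End Y) :=
  have : IsLocalRing (End X) := hX
  have : Nontrivial (End Y) := ⟨1, 0, fun h => not_isZero_of_isLocalRing hX
    (((IsZero.iff_id_eq_zero Y).2 h).of_iso e)⟩
  ⟨fun {a b} h => by
    have h' : (show End X from e.hom ≫ a ≫ e.inv) + (show End X from e.hom ≫ b ≫ e.inv) = 1 := by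
      change e.hom ≫ a ≫ e.inv + e.hom ≫ b ≫ e.inv = 𝟙 X
      rw [← Preadditive.comp_add, ← Preadditive.add_comp, show a + b = 𝟙 Y from h]
      simp
    rcases IsLocalRing.isUnit_or_isUnit_of_add_one h' with hu | hu
    · left
      have := (isUnit_iff_isIso _).1 hu
      have h2 : a = e.inv ≫ (e.hom ≫ a ≫ e.inv) ≫ e.hom := by simp
      rw [isUnit_iff_isIso, h2]
      infer_instance
    · right
      have := (isUnit_iff_isIso _).1 hu
      have h2 : b = e.inv ≫ (e.hom ≫ b ≫ e.inv) ≫ e.hom := by simp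
      rw [isUnit_iff_isIso, h2]
      infer_instance⟩

variable [HasFiniteBiproducts A]

/-- The multiplicity of `Y` as a direct summand of `X`: the largest `n` such that `Y^n` is a
direct summand of `X`. -/
def mult (Y X : A) : ℕ := sSup {n : ℕ | IsSummand (⨁ fun _ : Fin n => Y) X}

/-- The easy half of the Krull-Schmidt theorem: the summands isomorphic to `Y` bound its
multiplicity from below. -/
theorem isSummand_biproduct_card {ι : Type} [Fintype ι] (Y : A) (Z : ι → A) {n : ℕ}
    (σ : Fin n ↪ {i // Nonempty (Z i ≅ Y)}) :
    IsSummand (⨁ fun _ : Fin n => Y) (⨁ Z) := by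
  classical
  refine ⟨⟨biproduct.desc fun a => (σ a).2.some.inv ≫ biproduct.ι Z (σ a),
    biproduct.lift fun a => biproduct.π Z (σ a) ≫ (σ a).2.some.hom, ?_⟩⟩
  ext b a
  by_cases hab : a = b
  · subst hab; simp
  · have : ((σ a : {i // Nonempty (Z i ≅ Y)}) : ι) ≠ σ b := fun h =>
      hab (σ.injective (Subtype.ext h))
    simp [biproduct.ι_π_ne _ hab, biproduct.ι_π_ne_assoc _ this]

variable (k : Type*) [Field k] [IsAlgClosed k] [Linear k A]

theorem exists_residue_character_end [IsFinitaryCategory A k] {Y : A}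
    (hY : IsLocalRing (End Y)) :
    ∃ χ : (Y ⟶ Y) →+ k, χ (𝟙 Y) = 1 ∧ (∀ f g, χ (f ≫ g) = χ f * χ g) ∧
      ∀ f, χ f = 0 ↔ ¬ IsIso f := by
  have : FiniteDimensional k (End Y) := IsFinitaryCategory.finiteDimensional_hom Y Y
  obtain ⟨χ, hχ⟩ := exists_residue_character k (R := End Y)
  refine ⟨χ.toAddMonoidHom, χ.map_one, fun f g => ?_, fun f => ?_⟩
  · exact (χ.map_mul (show End Y from g) (show End Y from f)).trans (mul_comm _ _)
  · exact (hχ f).trans (not_congr (isUnit_iff_isIso f))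

/-- The uniqueness half of the Krull-Schmidt theorem: reducing the components of the retraction
modulo the maximal ideal of `End Y` factors the identity matrix of size `n` through the space
with basis the summands isomorphic to `Y`. -/
theorem le_card_of_isSummand [IsFinitaryCategory A k]
    {ι : Type} [Fintype ι] {Y : A} {Z : ι → A}
    (hY : IsLocalRing (End Y)) (hZ : ∀ i, IsLocalRing (End (Z i))) {n : ℕ}
    (h : IsSummand (⨁ fun _ : Fin n => Y) (⨁ Z)) :
    n ≤ Nat.card {i // Nonempty (Z i ≅ Y)} := by
  classical
  obtain ⟨r⟩ := h
  obtain ⟨χ, hχ1, hχm, hχ⟩ := exists_residue_character_end k hY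
  let s (a : Fin n) (i : ι) : Y ⟶ Z i :=
    biproduct.ι (fun _ : Fin n => Y) a ≫ r.i ≫ biproduct.π Z i
  let t (i : ι) (b : Fin n) : Z i ⟶ Y :=
    biproduct.ι Z i ≫ r.r ≫ biproduct.π (fun _ : Fin n => Y) b
  have hst : ∀ a b, ∑ i, s a i ≫ t i b = if a = b then 𝟙 Y else 0 := by
    intro a b
    have h1 : ∑ i, s a i ≫ t i b = (biproduct.ι (fun _ : Fin n => Y) a ≫ r.i) ≫
        (∑ i, biproduct.π Z i ≫ biproduct.ι Z i) ≫ r.r ≫ biproduct.π (fun _ : Fin n => Y) b := by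
      rw [Preadditive.sum_comp, Preadditive.comp_sum]
      simp only [s, t, Category.assoc]
    rw [biproduct.total, Category.id_comp, Category.assoc, r.retract_assoc] at h1
    refine h1.trans ?_
    by_cases hab : a = b
    · subst hab; simp
    · rw [if_neg hab, biproduct.ι_π_ne _ hab]
  have hzero : ∀ a b i, ¬ Nonempty (Z i ≅ Y) → χ (s a i ≫ t i b) = 0 := by
    intro a b i hi
    rw [hχ]
    intro hu
    have hr : IsSummand Y (Z i) := ⟨⟨s a i, t i b ≫ inv (s a i ≫ t i b), by
      rw [← Category.assoc]; exact IsIso.hom_inv_id _⟩⟩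
    exact hi ((hr.nonempty_iso (not_isZero_of_isLocalRing hY) (hZ i)).map Iso.symm)
  let I := {i // Nonempty (Z i ≅ Y)}
  let P : Matrix (Fin n) I k := fun a i => χ (s a i ≫ i.2.some.hom)
  let Q : Matrix I (Fin n) k := fun i b => χ (i.2.some.inv ≫ t i b)
  have hPQ : P * Q = 1 := by
    ext a b
    have h1 : ∀ i : I, P a i * Q i b = χ (s a i ≫ t i b) := by
      intro i
      change χ _ * χ _ = _
      rw [← hχm]
      simp
    rw [Matrix.mul_apply, Matrix.one_apply, Finset.sum_congr rfl fun i _ => h1 i]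
    have h2 : ∑ i : ι, χ (s a i ≫ t i b) = if a = b then 1 else 0 := by
      rw [← map_sum, hst]
      split_ifs
      · exact hχ1
      · exact map_zero χ
    rw [← h2]
    refine Fintype.sum_of_injective _ Subtype.val_injective _ _ (fun i hi => hzero a b i ?_)
      fun i => rfl
    exact fun h => hi ⟨⟨i, h⟩, rfl⟩
  have h3 := Matrix.rank_mul_le_left P Q
  rw [hPQ, Matrix.rank_one, Fintype.card_fin] at h3
  rw [Nat.card_eq_fintype_card]
  exact h3.trans (Matrix.rank_le_card_width P)

end KrullSchmidt

/-! ### Krull-Schmidt multiplicities -/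

section Multiplicities

variable {A : Type u₁} [Category.{v₁} A] [Preadditive A] [HasFiniteBiproducts A]
variable (k : Type*) [Field k] [Linear k A]

/-- Splitting off the first summand of a finite direct sum. -/
def biproductSuccIso {n : ℕ} (Y : Fin (n + 1) → A) :
    (⨁ Y) ≅ Y 0 ⊞ ⨁ fun i : Fin n => Y i.succ where
  hom := biprod.lift (biproduct.π Y 0) (biproduct.lift fun i => biproduct.π Y i.succ)
  inv := biprod.desc (biproduct.ι Y 0) (biproduct.desc fun i => biproduct.ι Y i.succ)
  hom_inv_id := by
    rw [biprod.lift_desc, biproduct.lift_desc, ← Fin.sum_univ_succ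
      (f := fun i => biproduct.π Y i ≫ biproduct.ι Y i), biproduct.total]
  inv_hom_id := by
    ext i j
    · simp
    · simp [biproduct.ι_π_ne Y (Fin.succ_ne_zero _).symm]
    · simp [biproduct.ι_π_ne Y (Fin.succ_ne_zero _)]
    · by_cases h : j = i
      · subst h; simp
      · have h' : j.succ ≠ i.succ := fun h'' => h (Fin.succ_injective _ h'')
        simp only [Category.assoc, biprod.inr_desc_assoc, biproduct.ι_desc_assoc, biprod.lift_snd,
          biproduct.lift_π, Category.comp_id, biprod.inr_snd_assoc]
        rw [biproduct.ι_π_ne _ h'.symm, biproduct.ι_π_ne _ (Ne.symm h)]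

theorem isLocalRing_end_of_indecomposable [IsFinitaryCategory A k] {X : A} (hX : Indecomposable X) :
    IsLocalRing (End X) := by
  obtain ⟨n, Y, hY, ⟨e⟩⟩ := IsFinitaryCategory.krullSchmidt k X
  cases n with
  | zero =>
    refine absurd (IsZero.of_iso ?_ e) hX.1
    rw [IsZero.iff_id_eq_zero]
    ext i
    exact i.elim0
  | succ n =>
    rcases hX.2 _ _ (e ≪≫ biproductSuccIso Y) with h | h
    · exact absurd h (not_isZero_of_isLocalRing (hY 0))
    · exact isLocalRing_end_of_iso (isoBiprodZero h ≪≫ (e ≪≫ biproductSuccIso Y).symm) (hY 0)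

theorem mult_congr {Y Y' X X' : A} (e : Y ≅ Y') (e' : X ≅ X') : mult Y X = mult Y' X' := by
  unfold mult
  congr 1
  ext n
  have i : (⨁ fun _ : Fin n => Y) ≅ ⨁ fun _ : Fin n => Y' := biproduct.mapIso fun _ => e
  exact ⟨fun h => (IsSummand.of_iso i.symm).trans (h.trans (IsSummand.of_iso e')),
    fun h => (IsSummand.of_iso i).trans (h.trans (IsSummand.of_iso e'.symm))⟩

open Classical in
theorem mult_eq_sum [IsAlgClosed k] [IsFinitaryCategory A k] {ι : Type} [Fintype ι]
    {X Y : A} {Z : ι → A} (hY : Indecomposable Y)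
    (hZ : ∀ i, IsLocalRing (End (Z i))) (e : X ≅ ⨁ Z) :
    mult Y X = ∑ i, if Nonempty (Z i ≅ Y) then 1 else 0 := by
  have hY' := isLocalRing_end_of_indecomposable k hY
  have h1 : (∑ i, if Nonempty (Z i ≅ Y) then 1 else 0) = Nat.card {i // Nonempty (Z i ≅ Y)} := by
    rw [Nat.card_eq_fintype_card, Fintype.card_subtype, Finset.card_filter]
  rw [h1]
  have hub : ∀ n, IsSummand (⨁ fun _ : Fin n => Y) X → n ≤ Nat.card {i // Nonempty (Z i ≅ Y)} :=
    fun n h => le_card_of_isSummand k hY' hZ (h.trans (IsSummand.of_iso e))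
  refine le_antisymm (csSup_le' hub) (le_csSup ⟨_, hub⟩ ?_)
  exact (isSummand_biproduct_card Y Z (Finite.equivFin _).symm.toEmbedding).trans
    (IsSummand.of_iso e.symm)

theorem mult_bddAbove [IsAlgClosed k] [IsFinitaryCategory A k] {Y : A} (hY : Indecomposable Y)
    (X : A) :
    BddAbove {n : ℕ | IsSummand (⨁ fun _ : Fin n => Y) X} := by
  obtain ⟨n, Z, hZ, ⟨e⟩⟩ := IsFinitaryCategory.krullSchmidt k X
  exact ⟨_, fun n h => le_card_of_isSummand k (isLocalRing_end_of_indecomposable k hY) hZ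
    (h.trans (IsSummand.of_iso e))⟩

theorem mult_pos_iff [IsAlgClosed k] [IsFinitaryCategory A k] {Y : A} (hY : Indecomposable Y)
    (X : A) : 0 < mult Y X ↔ IsSummand Y X := by
  constructor
  · intro h
    have hm : IsSummand (⨁ fun _ : Fin (mult Y X) => Y) X :=
      Nat.sSup_mem (s := {n : ℕ | IsSummand (⨁ fun _ : Fin n => Y) X})
        ⟨0, ⟨⟨0, 0, by ext i; exact i.elim0⟩⟩⟩ (mult_bddAbove k hY X)
    exact IsSummand.trans ⟨⟨biproduct.ι (fun _ : Fin (mult Y X) => Y) ⟨0, h⟩,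
      biproduct.π (fun _ : Fin (mult Y X) => Y) ⟨0, h⟩, by simp⟩⟩ hm
  · intro h
    have : 1 ≤ mult Y X := le_csSup (mult_bddAbove k hY X)
      (IsSummand.trans ⟨⟨biproduct.π (fun _ : Fin 1 => Y) 0, biproduct.ι (fun _ : Fin 1 => Y) 0, by
        ext i j
        fin_cases i
        fin_cases j
        simp⟩⟩ h)
    exact this

theorem mult_biproduct [IsAlgClosed k] [IsFinitaryCategory A k] {ι : Type} [Fintype ι] {Y : A}
    (hY : Indecomposable Y) (X : ι → A) :
    mult Y (⨁ X) = ∑ i, mult Y (X i) := by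
  choose n Z hZ e using fun i => IsFinitaryCategory.krullSchmidt k (X i)
  rw [mult_eq_sum k hY (Z := fun p : Σ i, Fin (n i) => Z p.1 p.2) (fun p => hZ _ _)
    (biproduct.mapIso (fun i => (e i).some) ≪≫ biproductBiproductIso (fun i => Fin (n i)) Z),
    Fintype.sum_sigma]
  exact Finset.sum_congr rfl fun i _ => (mult_eq_sum k hY (hZ i) (e i).some).symm

/-- A representative of a class of indecomposable objects. -/
def rep (s : IndClass A) : A := (_root_.Quotient.out s).1

theorem rep_indecomposable (s : IndClass A) : Indecomposable (rep s) :=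
  (_root_.Quotient.out s).2

/-- The class of an indecomposable object. -/
def indClass (X : A) (hX : Indecomposable X) : IndClass A := _root_.Quotient.mk _ ⟨X, hX⟩

theorem nonempty_iso_rep_iff {X : A} (hX : Indecomposable X) (s : IndClass A) :
    Nonempty (X ≅ rep s) ↔ indClass X hX = s := by
  constructor
  · intro h
    rw [← Quotient.out_eq s]
    exact _root_.Quotient.sound h
  · rintro rfl
    exact ⟨(Quotient.mk_out (s := (isIsomorphicSetoid A).comap
      (Subtype.val : {X : A // Indecomposable X} → A)) ⟨X, hX⟩).some.symm⟩

theorem rep_iso {X : A} (hX : Indecomposable X) : Nonempty (X ≅ rep (indClass X hX)) :=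
  (nonempty_iso_rep_iff hX _).2 rfl

theorem indClass_rep (s : IndClass A) : indClass (rep s) (rep_indecomposable s) = s :=
  Quotient.out_eq s

/-- Multiplicities in the image under an additive functor. -/
theorem mult_obj_eq_sum [IsAlgClosed k] [IsFinitaryCategory A k] {B : Type u₂}
    [Category.{v₂} B] [Preadditive B] [HasFiniteBiproducts B] [Linear k B] [IsFinitaryCategory B k]
    [Fintype (IndClass A)] (G : A ⥤ B) [G.Additive] {Y : B} (hY : Indecomposable Y) (X : A) :
    mult Y (G.obj X) = ∑ s : IndClass A, mult (rep s) X * mult Y (G.obj (rep s)) := by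
  classical
  obtain ⟨n, Z, hZ, ⟨e⟩⟩ := IsFinitaryCategory.krullSchmidt k X
  rw [mult_congr (Iso.refl Y) (G.mapIso e ≪≫ G.mapBiproduct Z), mult_biproduct k hY]
  have h1 : ∀ i, mult Y (G.obj (Z i)) =
      ∑ s : IndClass A, (if Nonempty (Z i ≅ rep s) then 1 else 0) * mult Y (G.obj (rep s)) := by
    intro i
    have hi := indecomposable_of_isLocalRing (hZ i)
    simp only [nonempty_iso_rep_iff hi, ite_mul, one_mul, zero_mul, Finset.sum_ite_eq,
      Finset.mem_univ, if_true]
    exact mult_congr (Iso.refl _) (G.mapIso (rep_iso hi).some)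
  refine (Finset.sum_congr rfl fun i _ => h1 i).trans ?_
  rw [Finset.sum_comm]
  refine Finset.sum_congr rfl fun s _ => ?_
  rw [mult_eq_sum k (rep_indecomposable s) hZ e, Finset.sum_mul]

/-- An indecomposable summand of `G X` is a summand of `G Z` for an indecomposable summand `Z`
of `X`. -/
theorem IsSummand.exists_indecomposable [IsAlgClosed k] [IsFinitaryCategory A k] {B : Type u₂}
    [Category.{v₂} B] [Preadditive B] [HasFiniteBiproducts B] [Linear k B]
    [IsFinitaryCategory B k] (G : A ⥤ B) [G.Additive]
    {Y : B} (hY : Indecomposable Y) {X : A} (h : IsSummand Y (G.obj X)) :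
    ∃ Z : A, Indecomposable Z ∧ IsSummand Z X ∧ IsSummand Y (G.obj Z) := by
  have : Finite (IndClass A) := IsFinitaryCategory.finite_indClass k
  have : Fintype (IndClass A) := Fintype.ofFinite _
  rw [← mult_pos_iff k hY, mult_obj_eq_sum k G hY] at h
  obtain ⟨s, -, hs⟩ := Finset.exists_ne_zero_of_sum_ne_zero h.ne'
  exact ⟨rep s, rep_indecomposable s,
    (mult_pos_iff k (rep_indecomposable s) X).1 (Nat.pos_of_ne_zero (left_ne_zero_of_mul hs)),
    (mult_pos_iff k hY _).1 (Nat.pos_of_ne_zero (right_ne_zero_of_mul hs))⟩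

theorem exists_indecomposable_summand [IsFinitaryCategory A k] {X : A} (hX : ¬ IsZero X) :
    ∃ Y : A, Indecomposable Y ∧ IsSummand Y X := by
  obtain ⟨n, Z, hZ, ⟨e⟩⟩ := IsFinitaryCategory.krullSchmidt k X
  cases n with
  | zero =>
    refine absurd (IsZero.of_iso ?_ e) hX
    rw [IsZero.iff_id_eq_zero]
    ext i
    exact i.elim0
  | succ n =>
    exact ⟨Z 0, indecomposable_of_isLocalRing (hZ 0),
      ⟨⟨biproduct.ι Z 0 ≫ e.inv, e.hom ≫ biproduct.π Z 0, by simp⟩⟩⟩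

end Multiplicities

/-! ### A positivity argument for block triangular matrices -/

section Positivity

open Polynomial

/-- A polynomial with a single sign change in its coefficients has a positive root `r`, and its
quotient by `X - r` has nonnegative coefficients. -/
theorem exists_root_of_one_sign_change {n k l : ℕ} {a : ℕ → ℝ} (hlk : l ≤ k) (hkn : k < n)
    (ha : ∀ i, 0 ≤ a i) (hal : a l ≠ 0) :
    ∃ (r : ℝ) (q : ℝ[X]), (X ^ n + ∑ i ∈ Finset.Ioo k n, C (a i) * X ^ i) -
        ∑ i ∈ Finset.Icc l k, C (a i) * X ^ i = q * (X - C r) ∧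
      (∀ j, 0 ≤ q.coeff j) ∧ 0 < q.coeff (n - 1) := by
  set p : ℝ[X] := (X ^ n + ∑ i ∈ Finset.Ioo k n, C (a i) * X ^ i) -
        ∑ i ∈ Finset.Icc l k, C (a i) * X ^ i with hp
  have hcoeff : ∀ j, p.coeff j = (if j = n then 1 else 0) +
      (if j ∈ Finset.Ioo k n then a j else 0) - (if j ∈ Finset.Icc l k then a j else 0) := by
    intro j
    simp [hp, coeff_X_pow, -Finset.mem_Ioo, -Finset.mem_Icc]
  have hlow : ∀ j, j ≤ k → p.coeff j ≤ 0 := by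
    intro j hj
    rw [hcoeff, if_neg (by omega), if_neg (by simp; omega)]
    split_ifs
    · linarith [ha j]
    · simp
  have hhigh : ∀ j, k < j → 0 ≤ p.coeff j := by
    intro j hj
    rw [hcoeff, if_neg (c := j ∈ Finset.Icc l k) (by simp; omega), sub_zero]
    have := ha j
    split_ifs <;> linarith
  have hpn : p.coeff n = 1 := by
    rw [hcoeff, if_pos rfl, if_neg (by simp), if_neg (by simp; omega)]; simp
  have hbig : ∀ j, n < j → p.coeff j = 0 := by
    intro j hj
    rw [hcoeff, if_neg (by omega), if_neg (by simp; omega), if_neg (by simp; omega)]; simp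
  -- `g` is the quotient of `p` by `X ^ l`
  let g : ℝ → ℝ := fun t => (t ^ (n - l) + ∑ i ∈ Finset.Ioo k n, a i * t ^ (i - l)) -
    ∑ i ∈ Finset.Icc l k, a i * t ^ (i - l)
  have hpg : ∀ t, p.eval t = t ^ l * g t := by
    intro t
    simp only [hp, g, eval_sub, eval_add, eval_pow, eval_X, eval_finsetSum, eval_mul, eval_C,
      mul_sub, mul_add, Finset.mul_sum, ← pow_add]
    have e1 : ∀ i, l ≤ i → t ^ l * (a i * t ^ (i - l)) = a i * t ^ i := by
      intro i hi
      rw [mul_left_comm, ← pow_add, Nat.add_sub_cancel' hi]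
    rw [Nat.add_sub_cancel' (by omega)]
    congr 1
    · congr 1
      exact Finset.sum_congr rfl fun i hi => (e1 i (by simp at hi; omega)).symm
    · exact Finset.sum_congr rfl fun i hi => (e1 i (by simp at hi; omega)).symm
  have hg0 : g 0 < 0 := by
    have h1 : ∑ i ∈ Finset.Ioo k n, a i * (0 : ℝ) ^ (i - l) = 0 :=
      Finset.sum_eq_zero fun i hi => by
        rw [zero_pow (by simp at hi; omega), mul_zero]
    have h2 : ∑ i ∈ Finset.Icc l k, a i * (0 : ℝ) ^ (i - l) = a l := by
      rw [Finset.sum_eq_single l]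
      · simp
      · intro i hi hne
        rw [zero_pow (by simp at hi; omega), mul_zero]
      · intro h; simp [hlk] at h
    simp only [g, h1, h2, zero_pow (show n - l ≠ 0 by omega)]
    linarith [lt_of_le_of_ne (ha l) hal.symm]
  set b : ℝ := 1 + ∑ i ∈ Finset.Icc l k, a i with hb
  have hb1 : 1 ≤ b := by
    have : 0 ≤ ∑ i ∈ Finset.Icc l k, a i := Finset.sum_nonneg fun i _ => ha i
    linarith
  have hgb : 0 ≤ g b := by
    have h1 : 0 ≤ ∑ i ∈ Finset.Ioo k n, a i * b ^ (i - l) :=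
      Finset.sum_nonneg fun i _ => mul_nonneg (ha i) (by positivity)
    have h2 : ∑ i ∈ Finset.Icc l k, a i * b ^ (i - l) ≤ ∑ i ∈ Finset.Icc l k, a i * b ^ (k - l) :=
      Finset.sum_le_sum fun i hi => mul_le_mul_of_nonneg_left
        (pow_le_pow_right₀ hb1 (by simp at hi; omega)) (ha i)
    have h3 : b ^ (k - l + 1) ≤ b ^ (n - l) := pow_le_pow_right₀ hb1 (by omega)
    have h4 : 0 ≤ b ^ (k - l) := by positivity
    rw [← Finset.sum_mul] at h2
    rw [pow_succ] at h3
    have h5 : b ^ (k - l) * b = b ^ (k - l) + (∑ i ∈ Finset.Icc l k, a i) * b ^ (k - l) := by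
      rw [hb]; ring
    simp only [g]
    linarith
  have hgc : Continuous g := by fun_prop
  obtain ⟨r, ⟨hr0, -⟩, hgr⟩ := intermediate_value_Icc (by linarith : (0 : ℝ) ≤ b)
    hgc.continuousOn (show (0 : ℝ) ∈ Set.Icc (g 0) (g b) from ⟨hg0.le, hgb⟩)
  have hr : 0 < r := lt_of_le_of_ne hr0 (by rintro rfl; linarith)
  have hroot : p.IsRoot r := by
    rw [IsRoot.def, hpg, hgr, mul_zero]
  obtain ⟨q, hq⟩ := dvd_iff_isRoot.2 hroot
  rw [mul_comm] at hq
  have hrec : ∀ j, p.coeff (j + 1) = q.coeff j - q.coeff (j + 1) * r := fun j => by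
    rw [hq, coeff_mul_X_sub_C]
  have hrec0 : p.coeff 0 = - (q.coeff 0 * r) := by
    rw [hq, mul_coeff_zero]; simp
  have hqn : ∀ j, n ≤ j → q.coeff j = 0 := by
    have hq0 : q ≠ 0 := by
      rintro rfl
      rw [zero_mul] at hq
      rw [hq] at hpn
      simp at hpn
    have hd : q.natDegree < n := by
      by_contra! hn
      have h1 := hrec q.natDegree
      rw [hbig _ (by omega), coeff_eq_zero_of_natDegree_lt (n := q.natDegree + 1) (by omega),
        zero_mul, sub_zero] at h1
      exact hq0 (leadingCoeff_eq_zero.1 h1.symm)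
    exact fun j hj => coeff_eq_zero_of_natDegree_lt (by omega)
  have hup : ∀ j, j ≤ k → 0 ≤ q.coeff j := by
    intro j
    induction j with
    | zero =>
      intro h
      have := hlow 0 h
      exact nonneg_of_mul_nonneg_left (by linarith) hr
    | succ j ih =>
      intro h
      have h1 := hlow _ h
      have h2 := ih (by omega)
      have h3 := hrec j
      exact nonneg_of_mul_nonneg_left (by linarith) hr
  have hdown : ∀ m j, n ≤ j + m → k ≤ j → 0 ≤ q.coeff j := by
    intro m
    induction m with
    | zero => intro j hj _; rw [hqn j hj]
    | succ m ih =>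
      intro j hj hk
      have h1 := ih (j + 1) (by omega) (by omega)
      have h2 := hhigh (j + 1) (by omega)
      have h3 := hrec j
      have := mul_nonneg h1 hr.le
      linarith
  refine ⟨r, q, hq, fun j => ?_, ?_⟩
  · rcases le_total j k with h | h
    · exact hup j h
    · exact hdown n j (by omega) h
  · have h := hrec (n - 1)
    rw [Nat.sub_add_cancel (by omega), hpn, hqn n le_rfl] at h
    linarith

/-- Let `T` be a nonnegative block triangular matrix whose two diagonal blocks are positive. If
`T` is annihilated by a polynomial with a single sign change in its coefficients, then the
off-diagonal block vanishes. With `r` the positive root of the polynomial and `A = q(T)` for the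
quotient `q` of the polynomial by `X - r`, one has `T A = r A = A T`. -/
theorem offdiagonal_eq_zero {ι : Type*} [Fintype ι] [DecidableEq ι] {T : Matrix ι ι ℝ} {S : Set ι}
    (h0 : ∀ s t, 0 ≤ T s t) (hSN : ∀ s ∈ S, ∀ t ∉ S, T s t = 0)
    (hSS : ∀ s ∈ S, ∀ t ∈ S, 0 < T s t) (hNN : ∀ s ∉ S, ∀ t ∉ S, 0 < T s t)
    {n k l : ℕ} {a : ℕ → ℝ} (hlk : l ≤ k) (hkn : k < n)
    (ha : ∀ i, 0 ≤ a i) (hal : a l ≠ 0)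
    (hT : T ^ n + ∑ i ∈ Finset.Ioo k n, a i • T ^ i = ∑ i ∈ Finset.Icc l k, a i • T ^ i) :
    ∀ s ∉ S, ∀ t ∈ S, T s t = 0 := by
  classical
  obtain ⟨r, q, hq, hq0, hqn⟩ := exists_root_of_one_sign_change hlk hkn ha hal
  have hpow0 : ∀ m s t, 0 ≤ (T ^ m) s t := by
    intro m
    induction m with
    | zero => intro s t; rw [pow_zero, Matrix.one_apply]; split_ifs <;> simp
    | succ m ih =>
      intro s t
      rw [pow_succ, Matrix.mul_apply]
      exact Finset.sum_nonneg fun u _ => mul_nonneg (ih _ _) (h0 _ _)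
  have hdiag : ∀ s, 0 < T s s := fun s => by
    by_cases h : s ∈ S
    · exact hSS s h s h
    · exact hNN s h s h
  have hpow : ∀ m s, 0 < (T ^ m) s s := by
    intro m
    induction m with
    | zero => intro s; simp
    | succ m ih =>
      intro s
      rw [pow_succ, Matrix.mul_apply]
      exact Finset.sum_pos' (fun u _ => mul_nonneg (hpow0 _ _ _) (h0 _ _))
        ⟨s, Finset.mem_univ _, mul_pos (ih s) (hdiag s)⟩
  set A : Matrix ι ι ℝ := aeval T q with hA
  have hAsum : ∀ s t, A s t = ∑ i ∈ Finset.range (q.natDegree + 1), q.coeff i * (T ^ i) s t := by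
    intro s t
    rw [hA, aeval_eq_sum_range, Matrix.sum_apply]
    simp
  have hA0 : ∀ s t, 0 ≤ A s t := fun s t => by
    rw [hAsum]
    exact Finset.sum_nonneg fun i _ => mul_nonneg (hq0 i) (hpow0 i s t)
  have hAd : ∀ s, 0 < A s s := fun s => by
    rw [hAsum]
    refine Finset.sum_pos' (fun i _ => mul_nonneg (hq0 i) (hpow0 i s s)) ⟨n - 1, ?_,
      mul_pos hqn (hpow _ s)⟩
    rw [Finset.mem_range, Nat.lt_succ_iff]
    exact le_natDegree_of_ne_zero hqn.ne'
  have hpT : aeval T (q * (X - C r)) = 0 := by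
    rw [← hq]
    simp only [map_sub, map_add, map_sum, map_mul, map_pow, aeval_X, aeval_C,
      ← Algebra.smul_def]
    rw [hT, sub_self]
  have hAT : A * T = r • A := by
    rw [map_mul, map_sub, aeval_X, aeval_C, mul_sub, sub_eq_zero] at hpT
    rw [hpT, ← Algebra.commutes, Algebra.smul_def]
  have hTA : T * A = r • A := by
    rw [← hAT]
    have := congrArg (aeval T) (mul_comm X q)
    rwa [map_mul, map_mul, aeval_X] at this
  intro s hs t ht
  -- `w` is the part in `S` of a column of `A`, and `ρ = (T - r) w` is supported outside `S`
  let w : ι → ℝ := fun u => if u ∈ S then A u t else 0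
  let ρ : ι → ℝ := T.mulVec w - r • w
  have hw : ∀ u, 0 ≤ w u := fun u => by
    simp only [w]; split_ifs
    · exact hA0 _ _
    · exact le_rfl
  have hρS : ∀ u ∈ S, ρ u = 0 := by
    intro u hu
    have h1 : T.mulVec w u = (T * A) u t := by
      rw [Matrix.mul_apply]
      refine Finset.sum_congr rfl fun x _ => ?_
      by_cases hx : x ∈ S
      · simp [w, hx]
      · simp [w, hx, hSN u hu x hx]
    simp only [ρ, Pi.sub_apply, Pi.smul_apply, h1, hTA, Matrix.smul_apply]
    simp [w, hu]
  have hρN : ∀ u ∉ S, ρ u = ∑ x, T u x * w x := by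
    intro u hu
    simp [ρ, w, hu, Matrix.mulVec, dotProduct]
  have hρ0 : ∀ u, 0 ≤ ρ u := by
    intro u
    by_cases hu : u ∈ S
    · rw [hρS u hu]
    · rw [hρN u hu]
      exact Finset.sum_nonneg fun x _ => mul_nonneg (h0 _ _) (hw x)
  have hAρ : A.mulVec ρ = 0 := by
    simp only [ρ, Matrix.mulVec_sub, Matrix.mulVec_mulVec, Matrix.mulVec_smul, hAT,
      Matrix.smul_mulVec, sub_self]
  have h1 : A s s * ρ s = 0 :=
    (Finset.sum_eq_zero_iff_of_nonneg (fun x _ => mul_nonneg (hA0 s x) (hρ0 x))).1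
      (congrFun hAρ s) s (Finset.mem_univ _)
  have h2 : ρ s = 0 := (mul_eq_zero.1 h1).resolve_left (hAd s).ne'
  rw [hρN s hs, Finset.sum_eq_zero_iff_of_nonneg fun x _ => mul_nonneg (h0 _ _) (hw x)] at h2
  have h3 := h2 t (Finset.mem_univ _)
  simp only [w, ht, if_true] at h3
  exact (mul_eq_zero.1 h3).resolve_right (hAd t).ne'

end Positivity

/-! ### Two-sided cells and the action of 1-morphisms -/

section Cells

variable {C : Type u} [Bicategory.{w, v} C] [∀ a b : C, Preadditive (a ⟶ b)]
  [∀ a b : C, HasFiniteBiproducts (a ⟶ b)]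

theorem exists_cls_eq (s : IndMor C) :
    ∃ (a b : C) (F : a ⟶ b) (hF : Indecomposable F), s = cls F hF := by
  obtain ⟨⟨a, b⟩, q⟩ := s
  induction q using _root_.Quotient.inductionOn with
  | h F => exact ⟨a, b, F.1, F.2, rfl⟩

theorem obj_eq_of_cls_eq {a b a' b' : C} {F : a ⟶ b} {hF : Indecomposable F} {G : a' ⟶ b'}
    {hG : Indecomposable G} (h : cls F hF = cls G hG) : a = a' ∧ b = b' :=
  Prod.mk.inj (congrArg Sigma.fst h)

theorem nonempty_iso_of_cls_eq {a b : C} {F : a ⟶ b} {hF : Indecomposable F} {G : a ⟶ b}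
    {hG : Indecomposable G} (h : cls F hF = cls G hG) : Nonempty (F ≅ G) :=
  _root_.Quotient.exact (eq_of_heq (Sigma.mk.inj h).2)

/-- Sandwiching 1-morphisms between two fixed ones. -/
def sandwich {a b c d : C} (H₁ : a ⟶ b) (H₂ : c ⟶ d) : (b ⟶ c) ⥤ (a ⟶ d) where
  obj F := H₁ ≫ F ≫ H₂
  map η := H₁ ◁ (η ▷ H₂)

theorem leJ_cls_iff {a b c d : C} {F : b ⟶ c} {hF : Indecomposable F} {G : a ⟶ d}
    {hG : Indecomposable G} :
    LeJ (cls F hF) (cls G hG) ↔ ∃ (H₁ : a ⟶ b) (H₂ : c ⟶ d), IsSummand G (H₁ ≫ F ≫ H₂) := by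
  constructor
  · rintro ⟨a', b', c', d', F', hF', G', hG', H₁, H₂, hs, ht, h⟩
    obtain ⟨rfl, rfl⟩ := obj_eq_of_cls_eq hs
    obtain ⟨rfl, rfl⟩ := obj_eq_of_cls_eq ht
    obtain ⟨e⟩ := nonempty_iso_of_cls_eq hs
    obtain ⟨e'⟩ := nonempty_iso_of_cls_eq ht
    exact ⟨H₁, H₂, (IsSummand.of_iso e').trans
      (h.trans (IsSummand.of_iso ((sandwich H₁ H₂).mapIso e.symm)))⟩
  · rintro ⟨H₁, H₂, h⟩
    exact ⟨a, b, c, d, F, hF, G, hG, H₁, H₂, rfl, rfl, h⟩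

theorem LeJ.refl (s : IndMor C) : LeJ s s := by
  obtain ⟨a, b, F, hF, rfl⟩ := exists_cls_eq s
  exact leJ_cls_iff.2 ⟨𝟙 a, 𝟙 b, IsSummand.of_iso ((ρ_ F).symm ≪≫ (λ_ _).symm)⟩

theorem LeJ.trans {s t r : IndMor C} (h : LeJ s t) (h' : LeJ t r) : LeJ s r := by
  obtain ⟨a, b, F, hF, rfl⟩ := exists_cls_eq s
  obtain ⟨a', b', G, hG, rfl⟩ := exists_cls_eq t
  obtain ⟨a'', b'', H, hH, rfl⟩ := exists_cls_eq r
  obtain ⟨H₁, H₂, h⟩ := leJ_cls_iff.1 h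
  obtain ⟨H₁', H₂', h'⟩ := leJ_cls_iff.1 h'
  refine leJ_cls_iff.2 ⟨H₁' ≫ H₁, H₂ ≫ H₂', h'.trans ((h.map (sandwich H₁' H₂')).trans
    (IsSummand.of_iso ?_))⟩
  exact whiskerLeftIso H₁' (α_ _ _ _ ≪≫ whiskerLeftIso H₁ (α_ _ _ _)) ≪≫ (α_ _ _ _).symm

theorem IsTwoSidedCell.nonempty {J : Set (IndMor C)} (hJ : IsTwoSidedCell J) : J.Nonempty := by
  obtain ⟨s, rfl⟩ := hJ
  exact ⟨s, LeJ.refl s, LeJ.refl s⟩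

theorem IsTwoSidedCell.leJ {J : Set (IndMor C)} (hJ : IsTwoSidedCell J) {s t : IndMor C}
    (hs : s ∈ J) (ht : t ∈ J) : LeJ s t := by
  obtain ⟨r, rfl⟩ := hJ
  exact hs.2.trans ht.1

theorem IsTwoSidedCell.mem {J : Set (IndMor C)} (hJ : IsTwoSidedCell J) {s t : IndMor C}
    (hs : s ∈ J) (h : LeJ s t) (h' : LeJ t s) : t ∈ J := by
  obtain ⟨r, rfl⟩ := hJ
  exact ⟨hs.1.trans h, h'.trans hs.2⟩

theorem IsTwoSidedCell.eq_of_mem {J J' : Set (IndMor C)} (hJ : IsTwoSidedCell J)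
    (hJ' : IsTwoSidedCell J') {s : IndMor C} (hs : s ∈ J) (hs' : s ∈ J') : J = J' := by
  ext t
  exact ⟨fun h => hJ'.mem hs' (hJ.leJ hs h) (hJ.leJ h hs),
    fun h => hJ.mem hs (hJ'.leJ hs' h) (hJ'.leJ h hs')⟩

theorem isTwoSidedCell_setOf (s : IndMor C) : IsTwoSidedCell {t | LeJ s t ∧ LeJ t s} := ⟨s, rfl⟩

theorem structureConstant_cls {a b c : C} {F : b ⟶ c} (hF : Indecomposable F) {G : a ⟶ b}
    (hG : Indecomposable G) {H : a ⟶ c} (hH : Indecomposable H) :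
    structureConstant (cls F hF) (cls G hG) (cls H hH) = mult H (G ≫ F) := by
  unfold structureConstant mult
  congr 1
  ext n
  constructor
  · rintro ⟨a', b', c', G', hG', F', hF', H', hH', hf, hg, hh, h⟩
    obtain ⟨rfl, rfl⟩ := obj_eq_of_cls_eq hf
    obtain ⟨rfl, -⟩ := obj_eq_of_cls_eq hg
    obtain ⟨eF⟩ := nonempty_iso_of_cls_eq hf
    obtain ⟨eG⟩ := nonempty_iso_of_cls_eq hg
    obtain ⟨eH⟩ := nonempty_iso_of_cls_eq hh
    exact (IsSummand.of_iso (biproduct.mapIso fun _ => eH)).trans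
      (h.trans (IsSummand.of_iso (whiskerRightIso eG.symm F' ≪≫ whiskerLeftIso G eF.symm)))
  · intro h
    exact ⟨a, b, c, G, hG, F, hF, H, hH, rfl, rfl, rfl, h⟩

/-- Classes which are not composable with the prescribed source and target have structure
constant zero. -/
theorem structureConstant_eq_zero {f g h : IndMor C}
    (hn : ¬ (g.1.1 = h.1.1 ∧ f.1.2 = h.1.2 ∧ g.1.2 = f.1.1)) : structureConstant f g h = 0 := by
  unfold structureConstant
  have h0 : {n : ℕ | ∃ (a b c : C) (G : a ⟶ b) (hG : Indecomposable G) (F : b ⟶ c)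
      (hF : Indecomposable F) (H : a ⟶ c) (hH : Indecomposable H),
      f = cls F hF ∧ g = cls G hG ∧ h = cls H hH ∧
        IsSummand (⨁ fun _ : Fin n => H) (G ≫ F)} = ∅ := by
    rw [Set.eq_empty_iff_forall_notMem]
    rintro n ⟨a, b, c, G, hG, F, hF, H, hH, rfl, rfl, rfl, -⟩
    exact hn ⟨rfl, rfl, rfl⟩
  rw [h0]
  exact csSup_empty

end Cells

section Representations

variable {k : Type*} [Field k] {C : Type u} [Bicategory.{w, v} C]
  [∀ a b : C, Preadditive (a ⟶ b)] [∀ a b : C, Linear k (a ⟶ b)]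
  [∀ a b : C, HasFiniteBiproducts (a ⟶ b)]

namespace FinRep

variable (M : FinRep.{w, v, u, v₁, u₁} k C)

/-- The functor `F ↦ F X` for an object `X`. -/
@[simps]
def evalAt {i : C} (j : C) (X : M.obj i) : (i ⟶ j) ⥤ M.obj j where
  obj F := M.act F X
  map α := (M.ps.map₂ α).toNatTrans.app X
  map_id F := by rw [M.ps.map₂_id]; rfl
  map_comp α β := by rw [M.ps.map₂_comp]; rfl

instance {i : C} (j : C) (X : M.obj i) : (M.evalAt j X).Additive where
  map_add {_ _ α β} := M.map₂_add α β X

/-- `(G ∘ F) X ≅ G (F X)`. -/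
def actComp {i j l : C} (F : i ⟶ j) (G : j ⟶ l) (X : M.obj i) :
    M.act (F ≫ G) X ≅ M.act G (M.act F X) :=
  (Cat.Hom.toNatIso (M.ps.mapComp F G)).app X

theorem inAnnihilator_id_iff {i j : C} (F : i ⟶ j) :
    M.InAnnihilator (𝟙 F) ↔ ∀ X : M.obj i, IsZero (M.act F X) := by
  refine forall_congr' fun X => ?_
  rw [IsZero.iff_id_eq_zero, M.ps.map₂_id]
  rfl

variable {M}

theorem isSummand_act {i j : C} (F : i ⟶ j) {X Y : M.obj i} (h : IsSummand X Y) :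
    IsSummand (M.act F X) (M.act F Y) := h.map (M.ps.map F).toFunctor

theorem isZero_act {i j : C} (F : i ⟶ j) {X : M.obj i} (h : IsZero X) : IsZero (M.act F X) :=
  (M.ps.map F).toFunctor.map_isZero h

theorem isSummand_act_comp {i j l : C} {F : i ⟶ j} {G : j ⟶ l} {X : M.obj i} {Y : M.obj j}
    {Z : M.obj l} (h : IsSummand Y (M.act F X)) (h' : IsSummand Z (M.act G Y)) :
    IsSummand Z (M.act (F ≫ G) X) :=
  h'.trans ((isSummand_act G h).trans (IsSummand.of_iso (M.actComp F G X).symm))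

theorem isZero_act_of_leJ {a b c d : C} {F : b ⟶ c} {hF : Indecomposable F} {G : a ⟶ d}
    {hG : Indecomposable G} (h : LeJ (cls F hF) (cls G hG)) (h0 : ∀ X, IsZero (M.act F X))
    (X : M.obj a) : IsZero (M.act G X) := by
  obtain ⟨H₁, H₂, h⟩ := leJ_cls_iff.1 h
  refine (h.map (M.evalAt d X)).isZero ?_
  refine IsZero.of_iso ?_ (M.actComp H₁ (F ≫ H₂) X)
  exact IsZero.of_iso (isZero_act H₂ (h0 _)) (M.actComp F H₂ _)

/-- A 1-morphism above a maximal surviving cell which does not act by zero belongs to this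
cell. -/
theorem IsMaximalSurvivingCell.mem_of_leJ {J : Set (IndMor C)} (hJ : M.IsMaximalSurvivingCell J)
    {s : IndMor C} (hs : s ∈ J) {i j : C} {F : i ⟶ j} {hF : Indecomposable F}
    (h : LeJ s (cls F hF)) (h0 : ¬ ∀ X, IsZero (M.act F X)) : cls F hF ∈ J := by
  rw [← hJ.2 {t | LeJ (cls F hF) t ∧ LeJ t (cls F hF)} ⟨isTwoSidedCell_setOf _, ?_⟩ ?_]
  · exact ⟨LeJ.refl _, LeJ.refl _⟩
  · intro i' j' G hG hm hG0
    exact h0 (isZero_act_of_leJ hm.2 ((M.inAnnihilator_id_iff G).1 hG0))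
  · exact fun s' hs' t ht => ((hJ.1.1.leJ hs' hs).trans h).trans ht.1

/-- The 1-morphisms in the apex already act transitively. -/
theorem IsTransitive.exists_mem_apex [IsAlgClosed k] [IsFinitary k C] (hM : M.IsTransitive)
    {J : Set (IndMor C)} (hJ : M.IsMaximalSurvivingCell J) {i j : C} {X : M.obj i} {Y : M.obj j}
    (hX : Indecomposable X) (hY : Indecomposable Y) :
    ∃ (F : i ⟶ j) (hF : Indecomposable F), cls F hF ∈ J ∧ IsSummand Y (M.act F X) := by
  -- pass from `X` to an object not killed by some `F` in `J`, apply `F`, and go on to `Y`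
  obtain ⟨s, hs⟩ := hJ.1.1.nonempty
  obtain ⟨a, b, F, hF, rfl⟩ := exists_cls_eq s
  have h0 := hJ.1.2 a b F hF hs
  rw [inAnnihilator_id_iff] at h0
  push Not at h0
  obtain ⟨X₀, hX₀⟩ := h0
  obtain ⟨Z, hZ, hZs⟩ := exists_indecomposable_summand k hX₀
  obtain ⟨X₁, hX₁, -, hZ₁⟩ := IsSummand.exists_indecomposable k (M.ps.map F).toFunctor hZ hZs
  obtain ⟨H₁, h₁⟩ := hM i a X X₁ hX hX₁
  obtain ⟨H₂, h₂⟩ := hM b j Z Y hZ hY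
  have := IsFinitary.finitary_hom (k := k) i j
  obtain ⟨G, hG, hGs, hGY⟩ := IsSummand.exists_indecomposable k (M.evalAt j X) hY
    (isSummand_act_comp h₁ (isSummand_act_comp hZ₁ h₂))
  exact ⟨G, hG, hJ.mem_of_leJ hs (leJ_cls_iff.2 ⟨H₁, H₂, hGs⟩)
    fun h => hY.1 (hGY.isZero (h X)), hGY⟩

/-- If `F` annihilates a 2-subrepresentation, then all morphisms from `F X` to it vanish: they
factor through `F F* Y`. -/
theorem eq_zero_of_isZero_act (hC : IsWeaklyFiat C) {P : M.ps.ObjectProperty}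
    [P.IsClosedUnderMapObj] {i j : C} {F : i ⟶ j}
    (hF : ∀ Y, P.prop i Y → IsZero (M.act F Y)) {X : M.obj i} {Y : M.obj j} (hY : P.prop j Y)
    (f : M.act F X ⟶ Y) : f = 0 := by
  obtain ⟨S⟩ := hC
  let adj : (M.ps.map F).toFunctor ⊣ (M.ps.map _).toFunctor :=
    CategoryTheory.Adjunction.ofCat (M.ps.mapAdjunction (S.adj F))
  have h1 := (adj.homEquiv_counit (X := X) (Y := Y) (g := adj.homEquiv X Y f))
  rw [Equiv.symm_apply_apply] at h1
  rw [h1, (hF _ (P.map_obj hY _)).eq_of_tgt ((M.ps.map F).toFunctor.map (adj.homEquiv X Y f)) 0,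
    zero_comp]

end FinRep
end Representations

/-! ### The action of the cell algebra by matrices -/

section ActionMatrix

variable {k : Type*} [Field k] {C : Type u} [Bicategory.{w, v} C]
  [∀ a b : C, Preadditive (a ⟶ b)] [∀ a b : C, Linear k (a ⟶ b)]
  [∀ a b : C, HasFiniteBiproducts (a ⟶ b)]

/-- Extension by zero of a function on `J` to all classes of indecomposable 1-morphisms. -/
def extendZero (J : Set (IndMor C)) : CellAlgebra J →ₗ[ℝ] (IndMor C → ℝ) where
  toFun x := Function.extend Subtype.val x 0
  map_add' x y := by
    rw [← Function.extend_add, add_zero]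
  map_smul' r x := by
    rw [RingHom.id_apply, ← Function.extend_smul, smul_zero]

theorem extendZero_coe {J : Set (IndMor C)} (x : CellAlgebra J) (s : J) :
    extendZero J x s = x s := Subtype.val_injective.extend_apply x 0 s

theorem extendZero_of_mem {J : Set (IndMor C)} (x : CellAlgebra J) {s : IndMor C} (hs : s ∈ J) :
    extendZero J x s = x ⟨s, hs⟩ := extendZero_coe x ⟨s, hs⟩

theorem extendZero_of_notMem {J : Set (IndMor C)} (x : CellAlgebra J) {s : IndMor C}
    (hs : s ∉ J) : extendZero J x s = 0 :=
  Function.extend_apply' _ _ _ fun ⟨t, ht⟩ => hs (ht ▸ t.2)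

/-- A class of indecomposable 1-morphisms from `a` to `b` as an element of `IndMor C`. -/
def homCls {a b : C} (c : IndClass (a ⟶ b)) : IndMor C := ⟨(a, b), c⟩

theorem cls_rep {a b : C} (c : IndClass (a ⟶ b)) :
    cls (rep c) (rep_indecomposable c) = homCls c :=
  congrArg (Sigma.mk (a, b)) (indClass_rep c)

theorem structureConstant_rep {a b c : C} (f : IndClass (b ⟶ c)) (g : IndClass (a ⟶ b))
    (h : IndClass (a ⟶ c)) :
    structureConstant (homCls f) (homCls g) (homCls h) = mult (rep h) (rep g ≫ rep f) := by
  rw [← cls_rep, ← cls_rep, ← cls_rep, structureConstant_cls]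

instance [Fintype C] [∀ a b : C, Fintype (IndClass (a ⟶ b))] : Fintype (IndMor C) :=
  inferInstanceAs (Fintype (Σ p : C × C, IndClass (p.1 ⟶ p.2)))

variable [Fintype C] [∀ a b : C, Fintype (IndClass (a ⟶ b))]

theorem cellMul_eq_sum {J : Set (IndMor C)} (y x : CellAlgebra J) {a c : C}
    (h : IndClass (a ⟶ c)) (hJ : homCls h ∈ J) :
    cellMul y x ⟨homCls h, hJ⟩ = ∑ b : C, ∑ g : IndClass (a ⟶ b), ∑ f : IndClass (b ⟶ c),
      extendZero J x (homCls g) * extendZero J y (homCls f) * mult (rep h) (rep g ≫ rep f) := by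
  classical
  let φ : IndMor C × IndMor C → ℝ := fun p =>
    extendZero J x p.2 * extendZero J y p.1 * structureConstant p.1 p.2 (homCls h)
  have h1 : cellMul y x ⟨homCls h, hJ⟩ = ∑ p, φ p := by
    have : Fintype J := Fintype.ofFinite _
    unfold cellMul
    rw [finsum_eq_sum_of_fintype]
    refine Fintype.sum_of_injective (fun p : J × J => ((p.1 : IndMor C), (p.2 : IndMor C)))
      (Subtype.val_injective.prodMap Subtype.val_injective) _ _ ?_ ?_
    · rintro ⟨f, g⟩ hfg
      by_cases hf : f ∈ J
      · have hg : g ∉ J := fun hg => hfg ⟨(⟨f, hf⟩, ⟨g, hg⟩), rfl⟩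
        simp [φ, extendZero_of_notMem x hg]
      · simp [φ, extendZero_of_notMem y hf]
    · rintro ⟨f, g⟩
      simp only [φ, extendZero_coe]
      ring
  let e : (Σ b : C, IndClass (a ⟶ b) × IndClass (b ⟶ c)) → IndMor C × IndMor C :=
    fun p => (homCls p.2.2, homCls p.2.1)
  have he : Function.Injective e := by
    rintro ⟨b, g, f⟩ ⟨b', g', f'⟩ hp
    obtain ⟨hp1, hp2⟩ := Prod.mk.inj hp
    obtain rfl : b = b' := congrArg (fun s : IndMor C => s.1.1) hp1
    have h1 := eq_of_heq (Sigma.mk.inj hp1).2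
    have h2 := eq_of_heq (Sigma.mk.inj hp2).2
    subst h1 h2
    rfl
  rw [h1, ← Fintype.sum_of_injective e he
    (fun p => extendZero J x (homCls p.2.1) * extendZero J y (homCls p.2.2) *
      mult (rep h) (rep p.2.1 ≫ rep p.2.2)) φ ?_ ?_, Fintype.sum_sigma]
  · simp only [Fintype.sum_prod_type]
  · rintro ⟨⟨⟨b, c'⟩, f⟩, ⟨⟨a', b'⟩, g⟩⟩ hfg
    have : structureConstant (C := C) ⟨(b, c'), f⟩ ⟨(a', b'), g⟩ (homCls h) = 0 := by
      apply structureConstant_eq_zero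
      rintro ⟨h1, h2, h3⟩
      dsimp only [homCls] at h1 h2 h3
      subst h1 h2 h3
      exact hfg ⟨⟨_, g, f⟩, rfl⟩
    simp only [φ, this, Nat.cast_zero, mul_zero]
  · rintro ⟨b, g, f⟩
    simp only [φ, e, structureConstant_rep]

theorem sum_mul_sum_eq_of_forall {α β γ δ : Type*} [Fintype α] [Fintype β] [Fintype γ]
    [Fintype δ] {x : β → ℝ} {y : γ → ℝ} {p : β → α → ℝ} {q : γ → α → ℝ} {p' : β → γ → δ → ℝ}
    {q' : δ → ℝ} (h : ∀ g f, ∑ r, p g r * q f r = ∑ d, p' g f d * q' d) :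
    ∑ r, (∑ g, x g * p g r) * (∑ f, y f * q f r) =
      ∑ d, (∑ g, ∑ f, x g * y f * p' g f d) * q' d := by
  have h1 : ∀ r, (∑ g, x g * p g r) * (∑ f, y f * q f r) =
      ∑ g, ∑ f, x g * y f * (p g r * q f r) := fun r => by
    rw [Finset.sum_mul_sum]
    exact Finset.sum_congr rfl fun g _ => Finset.sum_congr rfl fun f _ => by ring
  have h2 : ∀ d, (∑ g, ∑ f, x g * y f * p' g f d) * q' d =
      ∑ g, ∑ f, x g * y f * (p' g f d * q' d) := fun d => by
    simp only [Finset.sum_mul]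
    exact Finset.sum_congr rfl fun g _ => Finset.sum_congr rfl fun f _ => by ring
  simp only [h1, h2]
  rw [Finset.sum_comm, Finset.sum_comm (s := (Finset.univ : Finset δ))]
  refine Finset.sum_congr rfl fun g _ => ?_
  rw [Finset.sum_comm, Finset.sum_comm (s := (Finset.univ : Finset δ))]
  refine Finset.sum_congr rfl fun f _ => ?_
  rw [← Finset.mul_sum, ← Finset.mul_sum, h]

namespace FinRep

variable (M : FinRep.{w, v, u, v₁, u₁} k C)

/-- The isomorphism classes of indecomposable objects of `M`. -/
abbrev IndObj := Σ i : C, IndClass (M.obj i)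

/-- The matrix of multiplicities through which an element of `B^(J)` acts on the split
Grothendieck group of `M`; rows are indexed by the source. -/
def actionMatrix (J : Set (IndMor C)) : CellAlgebra J →ₗ[ℝ] Matrix M.IndObj M.IndObj ℝ where
  toFun x := Matrix.of fun s t => ∑ c : IndClass (s.1 ⟶ t.1),
    extendZero J x (homCls c) * mult (rep t.2) (M.act (rep c) (rep s.2))
  map_add' x y := by
    ext s t
    simp [add_mul, Finset.sum_add_distrib]
  map_smul' r x := by
    ext s t
    simp [mul_assoc, Finset.mul_sum]

theorem actionMatrix_apply {J : Set (IndMor C)} (x : CellAlgebra J) (s t : M.IndObj) :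
    M.actionMatrix J x s t = ∑ c : IndClass (s.1 ⟶ t.1),
      extendZero J x (homCls c) * mult (rep t.2) (M.act (rep c) (rep s.2)) := rfl

variable [IsAlgClosed k] [IsFinitary k C] [∀ i, Fintype (IndClass (M.obj i))]

variable {M} in
/-- If the summands outside `J` of composites of 1-morphisms in `J` act by zero, then the action
of `B^(J)` is multiplicative; the order of the factors is reversed because rows are indexed by the
source. -/
theorem actionMatrix_cellMul {J : Set (IndMor C)}
    (hJ : ∀ s ∈ J, ∀ {i j : C} (H : i ⟶ j) (hH : Indecomposable H), LeJ s (cls H hH) →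
      cls H hH ∉ J → ∀ X, IsZero (M.act H X)) (y x : CellAlgebra J) :
    M.actionMatrix J (cellMul y x) = M.actionMatrix J x * M.actionMatrix J y := by
  have hfin := fun i j : C => IsFinitary.finitary_hom (k := k) i j
  ext ⟨i, s⟩ ⟨l, t⟩
  -- both sides are the multiplicity of `t` in `f (g s)`
  have h1 : ∀ (b : C) (g : IndClass (i ⟶ b)) (f : IndClass (b ⟶ l)),
      ∑ r : IndClass (M.obj b), (mult (rep r) (M.act (rep g) (rep s)) : ℝ) *
          mult (rep t) (M.act (rep f) (rep r)) =
        ∑ h : IndClass (i ⟶ l), (mult (rep h) (rep g ≫ rep f) : ℝ) *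
          mult (rep t) (M.act (rep h) (rep s)) := by
    intro b g f
    have e1 := mult_obj_eq_sum k (M.ps.map (rep f)).toFunctor (rep_indecomposable t)
      (M.act (rep g) (rep s))
    have e2 := mult_obj_eq_sum k (M.evalAt l (rep s)) (rep_indecomposable t) (rep g ≫ rep f)
    have e3 := mult_congr (Iso.refl (rep t)) (M.actComp (rep g) (rep f) (rep s))
    have e4 := e1.symm.trans (e3.symm.trans e2)
    exact_mod_cast e4
  have h2 : (M.actionMatrix J x * M.actionMatrix J y) ⟨i, s⟩ ⟨l, t⟩ =
      ∑ h : IndClass (i ⟶ l), (∑ b : C, ∑ g : IndClass (i ⟶ b), ∑ f : IndClass (b ⟶ l),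
        extendZero J x (homCls g) * extendZero J y (homCls f) * mult (rep h) (rep g ≫ rep f)) *
          mult (rep t) (M.act (rep h) (rep s)) := by
    rw [Matrix.mul_apply, Fintype.sum_sigma]
    simp only [Finset.sum_mul (s := (Finset.univ : Finset C))]
    rw [Finset.sum_comm]
    refine Finset.sum_congr rfl fun b _ => ?_
    exact sum_mul_sum_eq_of_forall (α := IndClass (M.obj b))
      (x := fun g => extendZero J x (homCls g)) (y := fun f => extendZero J y (homCls f))
      (p := fun g r => mult (rep r) (M.act (rep g) (rep s)))
      (q := fun f r => mult (rep t) (M.act (rep f) (rep r)))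
      (p' := fun g f h => mult (rep h) (rep g ≫ rep f))
      (q' := fun h => mult (rep t) (M.act (rep h) (rep s))) (h1 b)
  rw [h2, actionMatrix_apply]
  refine Finset.sum_congr rfl fun h _ => ?_
  by_cases hh : homCls h ∈ J
  · rw [extendZero_of_mem _ hh, cellMul_eq_sum]
  · rw [extendZero_of_notMem _ hh, zero_mul]
    symm
    simp only [Finset.sum_mul]
    refine Finset.sum_eq_zero fun b _ => Finset.sum_eq_zero fun g _ =>
      Finset.sum_eq_zero fun f _ => ?_
    by_cases hg : homCls g ∈ J
    swap
    · simp [extendZero_of_notMem _ hg]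
    rcases Nat.eq_zero_or_pos (mult (rep h) (rep g ≫ rep f)) with h0 | h0
    · simp [h0]
    rcases Nat.eq_zero_or_pos (mult (rep t) (M.act (rep h) (rep s))) with h3 | h3
    · simp [h3]
    replace h0 := (mult_pos_iff k (rep_indecomposable _) _).1 h0
    replace h3 := (mult_pos_iff k (rep_indecomposable _) _).1 h3
    refine absurd (h3.isZero (hJ _ hg (rep h) (rep_indecomposable h) ?_ ?_ _))
      (rep_indecomposable t).1
    · rw [← cls_rep g]
      exact leJ_cls_iff.2 ⟨𝟙 i, rep f, h0.trans (IsSummand.of_iso (λ_ _).symm)⟩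
    · rwa [cls_rep]

variable {M} in
/-- The exponent is positive because `cellPow x 0` is not the identity. -/
theorem actionMatrix_cellPow [DecidableEq M.IndObj] {J : Set (IndMor C)}
    (hJ : ∀ s ∈ J, ∀ {i j : C} (H : i ⟶ j) (hH : Indecomposable H), LeJ s (cls H hH) →
      cls H hH ∉ J → ∀ X, IsZero (M.act H X)) (x : CellAlgebra J) (m : ℕ) :
    M.actionMatrix J (cellPow x (m + 1)) = M.actionMatrix J x ^ (m + 1) := by
  induction m with
  | zero => rw [zero_add, pow_one]; rfl
  | succ m ih => rw [pow_succ', ← ih, ← actionMatrix_cellMul hJ]; rfl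

theorem actionMatrix_nonneg {J : Set (IndMor C)} {x : CellAlgebra J} (hx : ∀ s, 0 < x s)
    (s t : M.IndObj) : 0 ≤ M.actionMatrix J x s t := by
  refine Finset.sum_nonneg fun c _ => mul_nonneg ?_ (Nat.cast_nonneg _)
  by_cases h : homCls c ∈ J
  · rw [extendZero_of_mem _ h]; exact (hx _).le
  · rw [extendZero_of_notMem _ h]

variable {M} in
theorem actionMatrix_pos {J : Set (IndMor C)} {x : CellAlgebra J} (hx : ∀ s, 0 < x s)
    {s t : M.IndObj} {F : s.1 ⟶ t.1} {hF : Indecomposable F} (hFJ : cls F hF ∈ J)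
    (h : IsSummand (rep t.2) (M.act F (rep s.2))) : 0 < M.actionMatrix J x s t := by
  refine Finset.sum_pos' (fun c _ => ?_) ⟨indClass F hF, Finset.mem_univ _, ?_⟩
  · refine mul_nonneg ?_ (Nat.cast_nonneg _)
    by_cases h : homCls c ∈ J
    · rw [extendZero_of_mem _ h]; exact (hx _).le
    · rw [extendZero_of_notMem _ h]
  · rw [extendZero_of_mem x (s := homCls (indClass F hF)) hFJ]
    refine mul_pos (hx _) (Nat.cast_pos.2 ((mult_pos_iff k (rep_indecomposable _) _).2 ?_))
    exact h.trans (IsSummand.of_iso ((M.evalAt t.1 (rep s.2)).mapIso (rep_iso hF).some))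

variable {M} in
theorem actionMatrix_eq_zero {J : Set (IndMor C)} (x : CellAlgebra J) {s t : M.IndObj}
    (h : ∀ F : s.1 ⟶ t.1, ¬ IsSummand (rep t.2) (M.act F (rep s.2))) :
    M.actionMatrix J x s t = 0 := by
  refine Finset.sum_eq_zero fun c _ => ?_
  have := h (rep c)
  rw [← mult_pos_iff k (rep_indecomposable _), Nat.pos_iff_ne_zero, not_not] at this
  rw [this, Nat.cast_zero, mul_zero]

end FinRep
end ActionMatrix

/-! ### Transfer from a 2-subrepresentation and from the quotient -/

section Transfer

variable {k : Type*} [Field k] {C : Type u} [Bicategory.{w, v} C]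
  [∀ a b : C, Preadditive (a ⟶ b)] [∀ a b : C, Linear k (a ⟶ b)]
  [∀ a b : C, HasFiniteBiproducts (a ⟶ b)]

/-- Endomorphism rings in the image of a full functor are quotients. -/
theorem isLocalRing_end_obj {A : Type u₁} [Category.{v₁} A] [Preadditive A] {B : Type u₂}
    [Category.{v₂} B] [Preadditive B] (G : A ⥤ B) [G.Additive] [G.Full] {X : A}
    (hX : IsLocalRing (End X)) (h0 : ¬ IsZero (G.obj X)) : IsLocalRing (End (G.obj X)) := by
  have : Nontrivial (End (G.obj X)) := ⟨1, 0, fun h => h0 ((IsZero.iff_id_eq_zero _).2 h)⟩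
  refine ⟨fun {a b} hab => ?_⟩
  obtain ⟨a', rfl⟩ := G.map_surjective (a : G.obj X ⟶ G.obj X)
  have hb : b = G.map (𝟙 X - a') := by
    rw [G.map_sub, G.map_id]
    exact eq_sub_of_add_eq' hab
  subst hb
  rcases IsLocalRing.isUnit_or_isUnit_of_add_one
    (show (show End X from a') + (show End X from 𝟙 X - a') = 1 from add_sub_cancel a' (𝟙 X))
    with hu | hu
  · exact Or.inl (hu.map (Functor.mapEnd X G))
  · exact Or.inr (hu.map (Functor.mapEnd X G))

theorem isLocalRing_end_of_isLocalRing_end_obj {A : Type u₁} [Category.{v₁} A] [Preadditive A]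
    {B : Type u₂} [Category.{v₂} B] [Preadditive B] (G : A ⥤ B) [G.Additive] [G.Full] [G.Faithful]
    {X : A}
    (hX : IsLocalRing (End (G.obj X))) : IsLocalRing (End X) := by
  have : Nontrivial (End X) := ⟨1, 0, fun h => not_isZero_of_isLocalRing hX
    (G.map_isZero ((IsZero.iff_id_eq_zero _).2 h))⟩
  refine ⟨fun {a b} hab => ?_⟩
  have h1 : (show End (G.obj X) from G.map a) + (show End (G.obj X) from G.map b) = 1 := by
    refine (G.map_add (f := a) (g := b)).symm.trans ?_
    rw [show a + b = 𝟙 X from hab, G.map_id]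
    rfl
  simp only [isUnit_iff_isIso]
  refine (IsLocalRing.isUnit_or_isUnit_of_add_one h1).imp (fun hu => ?_) fun hu => ?_
  · have : IsIso (G.map a) := (isUnit_iff_isIso _).1 hu
    exact isIso_of_reflects_iso a G
  · have : IsIso (G.map b) := (isUnit_iff_isIso _).1 hu
    exact isIso_of_reflects_iso b G

/-- Only the target is assumed to have biproducts, so that this applies to quotient categories. -/
theorem additive_of_isEquivalence {A : Type u₁} [Category.{v₁} A] [Preadditive A] {B : Type u₂}
    [Category.{v₂} B] [Preadditive B] [HasBinaryBiproducts B] (G : A ⥤ B) [G.IsEquivalence] :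
    G.Additive := by
  have : G.asEquivalence.inverse.PreservesZeroMorphisms :=
    Functor.preservesZeroMorphisms_of_isLeftAdjoint _
  have : PreservesBinaryBiproducts G.asEquivalence.inverse :=
    preservesBinaryBiproducts_of_preservesBinaryProducts _
  have : G.asEquivalence.symm.functor.Additive :=
    Functor.additive_of_preservesBinaryBiproducts G.asEquivalence.inverse
  exact G.asEquivalence.symm.inverse_additive

theorem IsSummand.of_map {A : Type u₁} [Category.{v₁} A] [Preadditive A] {B : Type u₂}
    [Category.{v₂} B] [Preadditive B] (G : A ⥤ B) [G.Full] [G.Faithful] {X Y : A}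
    (h : IsSummand (G.obj X) (G.obj Y)) : IsSummand X Y := by
  obtain ⟨r⟩ := h
  exact ⟨⟨G.preimage r.i, G.preimage r.r, G.map_injective (by simp [r.retract])⟩⟩

namespace FinRep

variable {M K N : FinRep.{w, v, u, v₁, u₁} k C} (P : M.ps.ObjectProperty) [M.IsSubrep P]

section Sub

variable {P} (η : P.fullsubcategory.StrongTrans K.ps)
  (hη : ∀ i : C, (η.app i).toFunctor.IsEquivalence)

/-- The component of an equivalence between a 2-subrepresentation and `K`. -/
def subFunctor (i : C) : P.Obj i ⥤ K.obj i := (η.app i).toFunctor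

/-- The compatibility of an equivalence with the action of 1-morphisms. -/
def subFunctorAct {i j : C} (F : i ⟶ j) (X : P.Obj i) :
    (subFunctor η j).obj ((P.map F).obj X) ≅ K.act F ((subFunctor η i).obj X) :=
  (Cat.Hom.toNatIso (η.naturality F)).app X

include hη

theorem isZero_act_of_sub {i j : C} {F : i ⟶ j} (h : ∀ Z, IsZero (K.act F Z)) {X : M.obj i}
    (hX : P.prop i X) : IsZero (M.act F X) := by
  have : (subFunctor η j).IsEquivalence := hη j
  have := additive_of_isEquivalence (subFunctor η j)
  have h1 : IsZero ((subFunctor η j).obj ((P.map F).obj ⟨X, hX⟩)) :=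
    (h _).of_iso (subFunctorAct η F ⟨X, hX⟩)
  have h2 : IsZero ((P.map F).obj ⟨X, hX⟩) := by
    rw [IsZero.iff_id_eq_zero] at h1 ⊢
    apply (subFunctor η j).map_injective
    rw [CategoryTheory.Functor.map_id, h1, Functor.map_zero]
  exact (P.prop j).ι.map_isZero h2

theorem indecomposable_subFunctor_obj {i : C} {X : M.obj i} (hX : P.prop i X)
    (h : Indecomposable X) : Indecomposable ((subFunctor η i).obj ⟨X, hX⟩) := by
  have : (subFunctor η i).IsEquivalence := hη i
  have := additive_of_isEquivalence (subFunctor η i)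
  have h1 : IsLocalRing (End (⟨X, hX⟩ : P.Obj i)) :=
    isLocalRing_end_of_isLocalRing_end_obj (P.prop i).ι (isLocalRing_end_of_indecomposable k h)
  refine indecomposable_of_isLocalRing (isLocalRing_end_obj _ h1 fun h0 => ?_)
  refine not_isZero_of_isLocalRing h1 ?_
  rw [IsZero.iff_id_eq_zero] at h0 ⊢
  apply (subFunctor η i).map_injective
  rw [CategoryTheory.Functor.map_id, h0, Functor.map_zero]

/-- The apex of `K` acts transitively on the indecomposable objects of the 2-subrepresentation. -/
theorem exists_mem_apex_of_sub [IsAlgClosed k] [IsFinitary k C] (hK : K.IsTransitive)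
    {J : Set (IndMor C)} (hJ : K.IsMaximalSurvivingCell J) {i j : C} {X : M.obj i} {Y : M.obj j}
    (hX : Indecomposable X) (hY : Indecomposable Y) (hXP : P.prop i X) (hYP : P.prop j Y) :
    ∃ (F : i ⟶ j) (hF : Indecomposable F), cls F hF ∈ J ∧ IsSummand Y (M.act F X) := by
  obtain ⟨F, hF, hFJ, h⟩ := hK.exists_mem_apex hJ (indecomposable_subFunctor_obj η hη hXP hX)
    (indecomposable_subFunctor_obj η hη hYP hY)
  have : (subFunctor η j).IsEquivalence := hη j
  have h1 := h.trans (IsSummand.of_iso (subFunctorAct η F ⟨X, hXP⟩).symm)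
  exact ⟨F, hF, hFJ, (IsSummand.of_map (subFunctor η j) h1).map (P.prop j).ι⟩

end Sub

section Quot

/-- Sums of morphisms factoring through `P` factor through `P`, as `P` is closed under direct
sums. -/
theorem mem_ideal_iff {i : C} {X Y : M.obj i} {f : X ⟶ Y} :
    f ∈ ideal P i X Y ↔ ∃ (Z : M.obj i) (a : X ⟶ Z) (b : Z ⟶ Y), P.prop i Z ∧ f = a ≫ b := by
  constructor
  · intro h
    unfold ideal at h
    induction h using AddSubgroup.closure_induction with
    | mem f h => exact h
    | zero =>
      obtain ⟨Z, -, hZ⟩ := (IsSubrep.containsZero (P := P) i).exists_zero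
      exact ⟨Z, 0, 0, hZ, by simp⟩
    | add f g _ _ hf hg =>
      obtain ⟨Z, a, b, hZ, rfl⟩ := hf
      obtain ⟨Z', a', b', hZ', rfl⟩ := hg
      exact ⟨Z ⊞ Z', biprod.lift a a', biprod.desc b b', IsSubrep.biprod i Z Z' hZ hZ', by simp⟩
    | neg f _ hf =>
      obtain ⟨Z, a, b, hZ, rfl⟩ := hf
      exact ⟨Z, -a, b, hZ, by simp⟩
  · exact fun h => AddSubgroup.subset_closure h

theorem prop_of_id_mem_ideal {i : C} {X : M.obj i} (h : 𝟙 X ∈ ideal P i X X) : P.prop i X := by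
  obtain ⟨Z, a, b, hZ, hab⟩ := (mem_ideal_iff P).1 h
  have := IsSubrep.stableUnderRetracts (P := P) i
  exact (P.prop i).prop_of_retract ⟨a, b, hab.symm⟩ hZ

theorem comp_mem_ideal {i : C} {W X Y Z : M.obj i} (f : W ⟶ X) {g : X ⟶ Y} (h : Y ⟶ Z)
    (hg : g ∈ ideal P i X Y) : f ≫ g ≫ h ∈ ideal P i W Z := by
  obtain ⟨V, a, b, hV, rfl⟩ := (mem_ideal_iff P).1 hg
  exact (mem_ideal_iff P).2 ⟨V, f ≫ a, b ≫ h, hV, by simp⟩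

instance (i : C) : Congruence (idealRel P i) where
  equivalence :=
    { refl := fun f => by simp only [idealRel, sub_self, zero_mem]
      symm := fun {f g} h => by
        have := neg_mem h
        rwa [neg_sub] at this
      trans := fun {f g h} h1 h2 => by
        have := add_mem h1 h2
        rwa [sub_add_sub_cancel] at this }
  comp_left f g g' h := by
    have := comp_mem_ideal P f (𝟙 _) h
    rwa [Category.comp_id, Preadditive.comp_sub] at this
  comp_right f h := by
    have := comp_mem_ideal P (𝟙 _) f h
    rwa [Category.id_comp, Preadditive.sub_comp] at this

theorem idealRel_add (i : C) ⦃X Y : M.obj i⦄ (f₁ f₂ g₁ g₂ : X ⟶ Y) (h : idealRel P i f₁ f₂)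
    (h' : idealRel P i g₁ g₂) : idealRel P i (f₁ + g₁) (f₂ + g₂) := by
  have := add_mem h h'
  rwa [← add_sub_add_comm] at this

instance quotPreadditive (i : C) : Preadditive (QuotObj P i) :=
  CategoryTheory.Quotient.preadditive _ (idealRel_add P i)

instance (i : C) : (CategoryTheory.Quotient.functor (idealRel P i)).Additive :=
  CategoryTheory.Quotient.functor_additive _ (idealRel_add P i)

variable {P} (η : (quotient P).StrongTrans N.ps)
  (hη : ∀ i : C, (η.app i).toFunctor.IsEquivalence)

/-- The projection from `M` to a 2-representation `N` equivalent to the quotient of `M`. -/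
def projFunctor (i : C) : M.obj i ⥤ N.obj i :=
  CategoryTheory.Quotient.functor (idealRel P i) ⋙
    (show QuotObj P i ⥤ N.obj i from (η.app i).toFunctor)

/-- The compatibility of the projection with the action of 1-morphisms. -/
def projFunctorAct {i j : C} (F : i ⟶ j) (X : M.obj i) :
    (projFunctor η j).obj (M.act F X) ≅ N.act F ((projFunctor η i).obj X) :=
  (Cat.Hom.toNatIso (η.naturality F)).app ((CategoryTheory.Quotient.functor (idealRel P i)).obj X)

include hη

theorem projFunctor_full (i : C) : (projFunctor η i).Full := by
  have : (show QuotObj P i ⥤ N.obj i from (η.app i).toFunctor).IsEquivalence := hη i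
  unfold projFunctor
  infer_instance

theorem projFunctor_additive (i : C) : (projFunctor η i).Additive := by
  have : (show QuotObj P i ⥤ N.obj i from (η.app i).toFunctor).IsEquivalence := hη i
  have := additive_of_isEquivalence (show QuotObj P i ⥤ N.obj i from (η.app i).toFunctor)
  unfold projFunctor
  infer_instance

theorem projFunctor_map_eq_iff {i : C} {X Y : M.obj i} (f g : X ⟶ Y) :
    (projFunctor η i).map f = (projFunctor η i).map g ↔ f - g ∈ ideal P i X Y := by
  have : (show QuotObj P i ⥤ N.obj i from (η.app i).toFunctor).IsEquivalence := hη i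
  exact ((show QuotObj P i ⥤ N.obj i from (η.app i).toFunctor).map_injective.eq_iff).trans
    (CategoryTheory.Quotient.functor_map_eq_iff (idealRel P i) f g)

theorem prop_of_isZero_projFunctor_obj {i : C} {X : M.obj i}
    (h : IsZero ((projFunctor η i).obj X)) : P.prop i X := by
  have := projFunctor_additive η hη i
  apply prop_of_id_mem_ideal
  rw [← sub_zero (𝟙 X), ← projFunctor_map_eq_iff η hη, Functor.map_zero]
  exact h.eq_of_src _ _

theorem indecomposable_projFunctor_obj {i : C} {X : M.obj i} (hX : ¬ P.prop i X)
    (h : Indecomposable X) : Indecomposable ((projFunctor η i).obj X) := by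
  have := projFunctor_additive η hη i
  have := projFunctor_full η hη i
  exact indecomposable_of_isLocalRing (isLocalRing_end_obj _ (isLocalRing_end_of_indecomposable k h)
    fun h0 => hX (prop_of_isZero_projFunctor_obj η hη h0))

/-- Outside the 2-subrepresentation, direct summands lift from the quotient: a lift of the
identity of `X` is invertible, as otherwise the local ring `End X` would have an invertible element
in the ideal. -/
theorem IsSummand.of_projFunctor {i : C} {X Z : M.obj i} (hX : ¬ P.prop i X)
    (h : Indecomposable X) (hs : IsSummand ((projFunctor η i).obj X) ((projFunctor η i).obj Z)) :
    IsSummand X Z := by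
  have := projFunctor_additive η hη i
  have := projFunctor_full η hη i
  obtain ⟨r⟩ := hs
  obtain ⟨a, ha⟩ := (projFunctor η i).map_surjective r.i
  obtain ⟨b, hb⟩ := (projFunctor η i).map_surjective r.r
  have hab : (projFunctor η i).map (𝟙 X) = (projFunctor η i).map (a ≫ b) := by
    rw [CategoryTheory.Functor.map_id, Functor.map_comp, ha, hb, r.retract]
  rw [projFunctor_map_eq_iff η hη] at hab
  have hloc := isLocalRing_end_of_indecomposable k h
  rcases IsLocalRing.isUnit_or_isUnit_of_add_one
    (show (show End X from a ≫ b) + (show End X from 𝟙 X - a ≫ b) = 1 from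
      add_sub_cancel (a ≫ b) (𝟙 X)) with hu | hu
  · have : IsIso (a ≫ b) := (isUnit_iff_isIso _).1 hu
    exact ⟨⟨a, b ≫ inv (a ≫ b), by rw [← Category.assoc]; exact IsIso.hom_inv_id _⟩⟩
  · have : IsIso (𝟙 X - a ≫ b) := (isUnit_iff_isIso _).1 hu
    refine absurd (prop_of_id_mem_ideal P ?_) hX
    have := comp_mem_ideal P (𝟙 X) (inv (𝟙 X - a ≫ b)) hab
    rwa [IsIso.hom_inv_id, Category.comp_id] at this

/-- The apex of `N` acts transitively on the indecomposable objects of `M` outside the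
2-subrepresentation. -/
theorem exists_mem_apex_of_quot [IsAlgClosed k] [IsFinitary k C] (hN : N.IsTransitive)
    {J : Set (IndMor C)} (hJ : N.IsMaximalSurvivingCell J) {i j : C} {X : M.obj i} {Y : M.obj j}
    (hX : Indecomposable X) (hY : Indecomposable Y) (hXP : ¬ P.prop i X) (hYP : ¬ P.prop j Y) :
    ∃ (F : i ⟶ j) (hF : Indecomposable F), cls F hF ∈ J ∧ IsSummand Y (M.act F X) := by
  obtain ⟨F, hF, hFJ, h⟩ := hN.exists_mem_apex hJ (indecomposable_projFunctor_obj η hη hXP hX)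
    (indecomposable_projFunctor_obj η hη hYP hY)
  exact ⟨F, hF, hFJ, IsSummand.of_projFunctor η hη hYP hY
    (h.trans (IsSummand.of_iso (projFunctorAct η F X).symm))⟩

theorem prop_act_of_quot {i j : C} {F : i ⟶ j} (h : ∀ Z, IsZero (N.act F Z)) (X : M.obj i) :
    P.prop j (M.act F X) :=
  prop_of_isZero_projFunctor_obj η hη ((h _).of_iso (projFunctorAct η F X))

end Quot

end FinRep
end Transfer

/-! ### Connecting 1-morphisms -/

namespace FinRep

variable {k : Type*} [Field k] [IsAlgClosed k] {C : Type u} [Bicategory.{w, v} C]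
  [∀ a b : C, Preadditive (a ⟶ b)] [∀ a b : C, Linear k (a ⟶ b)]
  [∀ a b : C, HasFiniteBiproducts (a ⟶ b)] [IsFinitary k C]
  {M K N : FinRep.{w, v, u, v₁, u₁} k C} {P : M.ps.ObjectProperty} [M.IsSubrep P]

/-- If `J` is good and acts transitively both on the 2-subrepresentation and on the quotient, then
no 1-morphism in `J` maps an object outside the 2-subrepresentation to an object with a summand
inside. -/
theorem not_isSummand_act_of_isGood {J : Set (IndMor C)} (hgood : IsGood J)
    (hJ : ∀ s ∈ J, ∀ {i j : C} (H : i ⟶ j) (hH : Indecomposable H), LeJ s (cls H hH) →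
      cls H hH ∉ J → ∀ X : M.obj i, IsZero (M.act H X))
    (hsub : ∀ {i j : C} {X : M.obj i} {Y : M.obj j}, Indecomposable X → Indecomposable Y →
      P.prop i X → P.prop j Y →
      ∃ (F : i ⟶ j) (hF : Indecomposable F), cls F hF ∈ J ∧ IsSummand Y (M.act F X))
    (hquot : ∀ {i j : C} {X : M.obj i} {Y : M.obj j}, Indecomposable X → Indecomposable Y →
      ¬ P.prop i X → ¬ P.prop j Y →
      ∃ (F : i ⟶ j) (hF : Indecomposable F), cls F hF ∈ J ∧ IsSummand Y (M.act F X))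
    {i j : C} {F : i ⟶ j} {hF : Indecomposable F} (hFJ : cls F hF ∈ J) {X : M.obj i}
    {Y : M.obj j} (hX : Indecomposable X) (hY : Indecomposable Y) (hXP : ¬ P.prop i X)
    (hYP : P.prop j Y) : ¬ IsSummand Y (M.act F X) := by
  classical
  intro hs
  have := IsFinitary.finite_obj k (C := C)
  have : Fintype C := Fintype.ofFinite C
  have : ∀ a b : C, Fintype (IndClass (a ⟶ b)) := fun a b =>
    have := IsFinitary.finitary_hom (k := k) a b
    have := IsFinitaryCategory.finite_indClass (A := a ⟶ b) k
    Fintype.ofFinite _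
  have : ∀ i, Fintype (IndClass (M.obj i)) := fun i =>
    have := IsFinitaryCategory.finite_indClass (A := M.obj i) k
    Fintype.ofFinite _
  obtain ⟨x, hx, n, l', l, a, hl, hlk, hkn, ha, hal, hrel⟩ := hgood
  have hpow : ∀ m, 1 ≤ m → M.actionMatrix J (cellPow x m) = M.actionMatrix J x ^ m := by
    intro m hm
    obtain ⟨m, rfl⟩ := Nat.exists_eq_add_of_le' hm
    exact actionMatrix_cellPow hJ x m
  have hT := congrArg (M.actionMatrix J) hrel
  simp only [map_add, map_sum, map_smul] at hT
  rw [hpow n (by omega)] at hT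
  rw [Finset.sum_congr rfl fun m hm => by
      rw [hpow m (by simp only [Finset.mem_Ioo] at hm; omega)],
    Finset.sum_congr (s₁ := Finset.Icc l l') rfl fun m hm => by
      rw [hpow m (by simp only [Finset.mem_Icc] at hm; omega)]] at hT
  let S : Set M.IndObj := {s | P.prop s.1 (rep s.2)}
  have hstable := IsSubrep.stableUnderRetracts (M := M) (P := P)
  have hzero := offdiagonal_eq_zero (T := M.actionMatrix J x) (S := S)
    (fun s t => M.actionMatrix_nonneg hx s t)
    (fun s hs t ht => actionMatrix_eq_zero x fun G hG => ht
      (have := hstable t.1; (P.prop t.1).prop_of_retract hG.some (P.map_obj hs G)))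
    (fun s hs t ht => by
      obtain ⟨G, hG, hGJ, h⟩ := hsub (rep_indecomposable s.2) (rep_indecomposable t.2) hs ht
      exact actionMatrix_pos hx hGJ h)
    (fun s hs t ht => by
      obtain ⟨G, hG, hGJ, h⟩ := hquot (rep_indecomposable s.2) (rep_indecomposable t.2) hs ht
      exact actionMatrix_pos hx hGJ h)
    hlk hkn ha hal hT
  obtain ⟨e⟩ := rep_iso hX
  obtain ⟨e'⟩ := rep_iso hY
  have h1 := hzero ⟨i, indClass X hX⟩ (fun h => hXP ((P.prop i).prop_of_iso e.symm h))
    ⟨j, indClass Y hY⟩ ((P.prop j).prop_of_iso e' hYP)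
  have h2 : 0 < M.actionMatrix J x ⟨i, indClass X hX⟩ ⟨j, indClass Y hY⟩ :=
    actionMatrix_pos hx hFJ ((IsSummand.of_iso e'.symm).trans
      (hs.trans (isSummand_act F (IsSummand.of_iso e))))
  exact h2.ne' h1

theorem theta_eq_empty (hC : IsWeaklyFiat C) (hK : K.IsTransitive) (hN : N.IsTransitive)
    {JK JN : Set (IndMor C)} (hJK : K.IsApex JK) (hJN : N.IsApex JN) (ha : IsGood JK)
    (hb : CellLeJ JK JN) {η : P.fullsubcategory.StrongTrans K.ps}
    (hη : ∀ i : C, (η.app i).toFunctor.IsEquivalence) {ζ : (quotient P).StrongTrans N.ps}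
    (hζ : ∀ i : C, (ζ.app i).toFunctor.IsEquivalence) : M.theta P = ∅ := by
  rw [Set.eq_empty_iff_forall_notMem]
  rintro _ ⟨i, j, F, hF, rfl, X, Y, hX, hXP, hY, hYP, hs⟩
  -- 1-morphisms annihilating the 2-subrepresentation do not connect the two parts of `M`
  have hadj : ∀ {a b : C} {G : a ⟶ b} {Z : M.obj a} {W : M.obj b}, P.prop b W →
      Indecomposable W → IsSummand W (M.act G Z) → ¬ ∀ V, P.prop a V → IsZero (M.act G V) := by
    intro a b G Z W hW hWi h h0
    obtain ⟨r⟩ := h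
    refine hWi.1 ((IsZero.iff_id_eq_zero _).2 ?_)
    rw [← r.retract, eq_zero_of_isZero_act hC h0 hW r.r, comp_zero]
  by_cases hJ : JK = JN
  · subst hJ
    obtain ⟨G, hG, hGJ, hGY⟩ := exists_mem_apex_of_sub η hη hK hJK.1 hY hY hYP hYP
    have := IsFinitary.finitary_hom (k := k) i j
    -- a summand of `G ∘ F` connecting `X` to `Y` lies in the apex
    obtain ⟨H, hH, hHs, hHY⟩ := IsSummand.exists_indecomposable k (M.evalAt j X) hY
      (isSummand_act_comp hs hGY)
    have hHJ : cls H hH ∈ JK := by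
      refine hJK.1.mem_of_leJ hGJ (leJ_cls_iff.2 ⟨F, 𝟙 j, hHs.trans
        (IsSummand.of_iso (whiskerLeftIso F (ρ_ G).symm))⟩) fun h0 => ?_
      exact hadj hYP hY hHY fun V hV => isZero_act_of_sub η hη h0 hV
    refine not_isSummand_act_of_isGood ha ?_ (exists_mem_apex_of_sub η hη hK hJK.1)
      (exists_mem_apex_of_quot ζ hζ hN hJN.1) hHJ hX hY hXP hYP hHY
    intro s hs a b E hE hle hEJ Z
    have hEK : ∀ V, IsZero (K.act E V) := by
      by_contra h
      exact hEJ (hJK.1.mem_of_leJ hs hle h)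
    have hEN : ∀ V, IsZero (N.act E V) := by
      by_contra h
      exact hEJ (hJN.1.mem_of_leJ hs hle h)
    rw [IsZero.iff_id_eq_zero]
    exact eq_zero_of_isZero_act hC (fun V hV => isZero_act_of_sub η hη hEK hV)
      (prop_act_of_quot ζ hζ hEN Z) _
  · obtain ⟨G, hG, hGJ, hGX⟩ := exists_mem_apex_of_quot ζ hζ hN hJN.1 hX hX hXP hXP
    obtain ⟨s, hs'⟩ := hJK.1.1.1.nonempty
    have hGK : ∀ V, IsZero (K.act G V) := by
      by_contra h
      exact hJ (hJK.1.1.1.eq_of_mem hJN.1.1.1 (hJK.1.mem_of_leJ hs' (hb s hs' _ hGJ) h) hGJ)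
    refine hadj hYP hY (isSummand_act_comp hGX hs) fun V hV => ?_
    exact (isZero_act F (isZero_act_of_sub η hη hGK hV)).of_iso (M.actComp G F V)

end FinRep

end Finitary

end

/-- Let `C` be weakly fiat and `K`, `N` transitive 2-representations with apexes `JK`, `JN`.
If `JK` is good, `JK ≤_J JN`, and every left cell in `JN` is `≥_L` some left cell in `JK`, then
`Dext(N, K)` is empty. -/
theorem theorem41 {k : Type*} [Field k] [IsAlgClosed k] {C : Type u} [Bicategory.{w, v} C]
    [∀ a b : C, Preadditive (a ⟶ b)] [∀ a b : C, Linear k (a ⟶ b)]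
    [∀ a b : C, HasFiniteBiproducts (a ⟶ b)] [Finitary.IsFinitary k C]
    (hC : Finitary.IsWeaklyFiat C)
    (K N : Finitary.FinRep.{w, v, u, v₁, u₁} k C)
    (hK : K.IsTransitive) (hN : N.IsTransitive)
    (JK JN : Set (Finitary.IndMor C)) (hJK : K.IsApex JK) (hJN : N.IsApex JN)
    (ha : Finitary.IsGood JK)
    (hb : Finitary.CellLeJ JK JN)
    (hc : ∀ L : Set (Finitary.IndMor C), Finitary.IsLeftCell L → L ⊆ JN →
      ∃ L' : Set (Finitary.IndMor C), Finitary.IsLeftCell L' ∧ L' ⊆ JK ∧ Finitary.CellLeL L' L) :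
    Finitary.FinRep.Dext N K = ∅ := by
  rw [Set.eq_empty_iff_forall_notMem]
  rintro _ ⟨hne, M, P, hP, ⟨η, hη⟩, ⟨ζ, hζ⟩, rfl⟩
  exact hne.ne_empty (Finitary.FinRep.theta_eq_empty hC hK hN hJK hJN ha hb hη hζ)
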